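/- Let $(V,Y,\mathbf 1,\omega)$ be a vertex operator algebra over $\mathbb C$ with $V=\bigoplus_{n\in\mathbb Z}V_n$, and let $g$ be an automorphism of $V$ of finite order $T$. For $0\le r\le T-1$ put $V^r=\{a\in V: ga=e^{2\pi i r/T}a\}$, and let $\delta(r)=1$ if $r=0$ and $\delta(r)=0$ otherwise; $V^0$ is a vertex operator algebra. Write $Y_M(a,z)=\sum_n a_{(n)}z^{-n-1}$, $L(n)=\omega_{(n+1)}$. For a (weak, untwisted) $V$-module $M$, $a\in V^r$ homogeneous of weight $\mathrm{wt}\,a$, and $x\in M$, let $$a\circ_g x=\mathrm{Res}_z\frac{(1+z)^{\mathrm{wt}\,a-1+\delta(r)+r/T}}{z^{1+\delta(r)}}Y_M(a,z)x,$$ $$a*_g x=\mathrm{Res}_z\frac{(1+z)^{\mathrm{wt}\,a}}{z}Y_M(a,z)x,\qquad x*_g a=\mathrm{Res}_z\frac{(1+z)^{\mathrm{wt}\,a-1}}{z}Y_M(a,z)x\qquad(r=0),$$ and $a*_gx=x*_ga=0$ if $r\ne0$. Let $O_g(V)=\mathrm{span}\{a\circ_g b: a,b\in V\}$ and $A_g(V)=V/O_g(V)$;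 let $A(V^0)$ be the same construction for the vertex operator algebra $V^0$ and its identity automorphism. For $\lambda\in\mathbb C$ let $O_{g,\lambda}(M)=\mathrm{span}\{a\circ_g x,\ L(-1)x+(L(0)+\lambda)x: a\in V,\ x\in M\}$ and $B_{g,\lambda}(M)=M/O_{g,\lambda}(M)$. Classes are denoted by $[\cdot]$. Let $M^1=\bigoplus_{n\in\mathbb N}M^1(n)$ be an admissible untwisted $V$-module of conformal weight $h_1$, i.e. $M^1(n)$ is the $L(0)$-eigenspace of eigenvalue $h_1+n$. Then: 1. The product $[a][b]=[a*_gb]$ makes $A_g(V)$ an associative $\mathbb C$-algebra with identity $[\mathbf 1]$; likewise $A(V^0)$ is an associative algebra, and $[a]\mapsto[a]$ defines an epimorphism of algebras $A(V^0)\to A_g(V)$. 2. For every $\lambda\in\mathbb C$, $B_{g,\lambda}(M^1)$ is an $A_g(V)$-bimodule with $[a]\cdot[x]=[a*_gx]$ and $[x]\cdot[a]=[x*_ga]$; hence it is an $A(V^0)$-bimodule by restriction. 3. Let $U^2$ be an irreducible left and $U^3$ an irreducible right $A_g(V)$-module, on which $[\omega]$ acts as $h_2\,\mathrm{id}$ and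 $h_3\,\mathrm{id}$ respectively ($h_2,h_3\in\mathbb C$), and put $h=h_1+h_2-h_3$. Let $J\subseteq U^3\otimes M^1\otimes U^2$ be the span of the elements $$u_3\otimes(L(-1)+L(0)-h_1+h)x\otimes u_2,$$ $$u_3\cdot[a]\otimes x\otimes u_2-\sum_{j\ge0}\binom{\mathrm{wt}\,a}{j}u_3\otimes a_{(j-1)}x\otimes u_2,\qquad a\in V^0,$$ $$u_3\otimes x\otimes[a]\cdot u_2-\sum_{j\ge0}\binom{\mathrm{wt}\,a-1}{j}u_3\otimes a_{(j-1)}x\otimes u_2,\qquad a\in V^0,$$ $$\sum_{j\ge0}\binom{\mathrm{wt}\,a-1+\frac rT}{j}u_3\otimes a_{(j-1)}x\otimes u_2,\qquad a\in V^r,\ r\ne0,$$ with $a$ homogeneous, $u_3\in U^3$, $x\in M^1$, $u_2\in U^2$. Then, with $\lambda=h_2-h_3$, there are isomorphisms of vector spaces $$(U^3\otimes M^1\otimes U^2)/J\;\cong\;U^3\otimes_{A_g(V)}B_{g,\lambda}(M^1)\otimes_{A_g(V)}U^2\;\cong\;U^3\otimes_{A(V^0)}B_{g,\lambda}(M^1)\otimes_{A(V^0)}U^2,$$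 where $A(V^0)$ acts through $A(V^0)\to A_g(V)$; they send the class of $u_3\otimes x\otimes u_2$ to $u_3\otimes[x]\otimes u_2$, and $u_3\otimes[x]\otimes u_2$ to $u_3\otimes[x]\otimes u_2$. -/

import Mathlib

open scoped TensorProduct DirectSum

noncomputable section

namespace TwistedZhu

universe u v w

section Basics

variable {V : Type u} [AddCommGroup V] [Module ℂ V] {M : Type v} [AddCommGroup M] [Module ℂ M]

/-- The mode `a_(n)` of the field `Y(a, z) = ∑ₙ a_(n) z^(-n-1)`. -/
abbrev mode (Y : V →ₗ[ℂ] VertexOperator ℂ M) (a : V) (n : ℤ) : Module.End ℂ M :=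
  VertexOperator.ncoeff (Y a) n

/-- The (untwisted) Jacobi identity in component form, for fields `Y(·, z)` of `V` on itself and
`YM(·, z)` of `V` on `M`: for all `a b ∈ V`, `x ∈ M` and `l m n ∈ ℤ`,
`∑ᵢ (-1)ⁱ C(l,i) a_(m+l-i) b_(n+i) x - ∑ᵢ (-1)^(l+i) C(l,i) b_(n+l-i) a_(m+i) x
  = ∑ⱼ C(m,j) (a_(l+j) b)_(m+n-j) x`.
All three sums are finite because a field applied to a vector is a Laurent series. -/
def JacobiIdentity (Y : V →ₗ[ℂ] VertexOperator ℂ V) (YM : V →ₗ[ℂ] VertexOperator ℂ M) : Prop :=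
  ∀ (a b : V) (x : M) (l m n : ℤ),
    (∑ᶠ i : ℕ, ((-1) ^ i * Ring.choose l i : ℤ) •
        mode YM a (m + l - i) (mode YM b (n + i) x)) -
      (∑ᶠ i : ℕ, ((Int.negOnePow (l + i) : ℤ) * Ring.choose l i) •
        mode YM b (n + l - i) (mode YM a (m + i) x)) =
    ∑ᶠ j : ℕ, (Ring.choose m j : ℤ) • mode YM (mode Y a (l + j) b) (m + n - j) x

end Basics

/-- A vertex operator algebra `(V, Y, 𝟙, ω)` over `ℂ`. The field `Y(a, z)` sends a vector to a Laurent
series (truncation). The homogeneous subspace `V_n` is the `n`-eigenspace of `L(0) = ω_(1)`. -/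
class VOA (V : Type u) [AddCommGroup V] [Module ℂ V] where
  /-- The state-field correspondence `a ↦ Y(a, z)`. -/
  Y : V →ₗ[ℂ] VertexOperator ℂ V
  /-- The vacuum vector. -/
  vac : V
  /-- The conformal vector. -/
  omega : V
  /-- The central charge. -/
  charge : ℂ
  vac_mode : ∀ n : ℤ, mode Y vac n = if n = -1 then 1 else 0
  creation : ∀ a : V, mode Y a (-1) vac = a ∧ ∀ n : ℤ, 0 ≤ n → mode Y a n vac = 0
  jacobi : JacobiIdentity Y Y
  /-- The Virasoro relations for `L(m) = ω_(m+1)`. -/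
  virasoro : ∀ (m n : ℤ) (x : V),
    mode Y omega (m + 1) (mode Y omega (n + 1) x) - mode Y omega (n + 1) (mode Y omega (m + 1) x) =
      ((m : ℂ) - n) • mode Y omega (m + n + 1) x +
        (if m + n = 0 then (((m : ℂ) ^ 3 - m) / 12 * charge) • x else 0)
  /-- `Y(L(-1) a, z) = d/dz Y(a, z)`. -/
  derivative : ∀ (a : V) (n : ℤ), mode Y (mode Y omega 0 a) n = (-n : ℂ) • mode Y a (n - 1)
  /-- `V = ⨁ₙ V_n`. -/
  grading : DirectSum.IsInternal (fun n : ℤ => Module.End.eigenspace (mode Y omega 1) (n : ℂ))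
  finite_weight : ∀ n : ℤ,
    FiniteDimensional ℂ (Module.End.eigenspace (mode Y omega 1) (n : ℂ))
  bounded_below : ∃ N : ℤ, ∀ n < N, Module.End.eigenspace (mode Y omega 1) (n : ℂ) = ⊥

section VOABasics

variable (V : Type u) [AddCommGroup V] [Module ℂ V] [VOA V]

/-- The homogeneous subspace `V_n`. -/
def wtSpace (n : ℤ) : Submodule ℂ V :=
  Module.End.eigenspace (mode (VOA.Y (V := V)) VOA.omega 1) (n : ℂ)

/-- A weak (untwisted) module over the vertex operator algebra `V`. -/
class WeakModule (M : Type v) [AddCommGroup M] [Module ℂ M] where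
  /-- The module fields `a ↦ Y_M(a, z)`. -/
  YM : V →ₗ[ℂ] VertexOperator ℂ M
  vac_mode : ∀ n : ℤ, mode YM VOA.vac n = if n = -1 then 1 else 0
  jacobi : JacobiIdentity VOA.Y YM

/-- The adjoint module. -/
instance adjointModule : WeakModule V V where
  YM := VOA.Y
  vac_mode := VOA.vac_mode
  jacobi := VOA.jacobi

variable {V}
variable {M : Type v} [AddCommGroup M] [Module ℂ M] [WeakModule V M]

/-- `a_(n) x` for `a ∈ V` and `x` in a weak module. -/
def act (a : V) (n : ℤ) : Module.End ℂ M := mode (WeakModule.YM (V := V) (M := M)) a n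

variable (V M)

/-- The operator `L(0) = ω_(1)` on a weak module. -/
def L0 : Module.End ℂ M := act (VOA.omega : V) 1

/-- The operator `L(-1) = ω_(0)` on a weak module. -/
def Lm1 : Module.End ℂ M := act (VOA.omega : V) 0

/-- An admissible (untwisted) module structure: a grading `M = ⨁_{n ∈ ℕ} M(n)` such that
`a_(m) M(n) ⊆ M(wt a - m - 1 + n)` for `a` homogeneous, where `M(k) = 0` for `k < 0`. -/
structure AdmissibleGrading where
  /-- The subspace `M(n)`. -/
  gr : ℕ → Submodule ℂ M
  isInternal : DirectSum.IsInternal gr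
  act_mem : ∀ (k : ℤ) (a : V), a ∈ wtSpace V k → ∀ (m : ℤ) (n : ℕ) (x : M), x ∈ gr n →
    (∀ p : ℕ, (p : ℤ) = k - m - 1 + n → act a m x ∈ gr p) ∧
    (k - m - 1 + n < 0 → act a m x = 0)

variable {V M}

/-- The admissible module is of conformal weight `h`: the subspace `M(n)` is precisely the
eigenspace of `L(0)` for the eigenvalue `h + n`. -/
def AdmissibleGrading.HasConformalWeight (G : AdmissibleGrading V M) (h : ℂ) : Prop :=
  ∀ n : ℕ, G.gr n = Module.End.eigenspace (L0 V M) (h + n)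

end VOABasics

section Automorphisms

/-- An automorphism of the vertex operator algebra `V`. -/
structure Aut (V : Type u) [AddCommGroup V] [Module ℂ V] [VOA V] where
  /-- The underlying linear automorphism. -/
  toEquiv : V ≃ₗ[ℂ] V
  map_mode : ∀ (a b : V) (n : ℤ),
    toEquiv (mode VOA.Y a n b) = mode VOA.Y (toEquiv a) n (toEquiv b)
  map_vac : toEquiv VOA.vac = VOA.vac
  map_omega : toEquiv VOA.omega = VOA.omega

variable {V : Type u} [AddCommGroup V] [Module ℂ V] [VOA V]

/-- The identity automorphism. -/
def Aut.one (V : Type u) [AddCommGroup V] [Module ℂ V] [VOA V] : Aut V where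
  toEquiv := 1
  map_mode _ _ _ := rfl
  map_vac := rfl
  map_omega := rfl

/-- The order `T` of `g` (it is `0` when the order is infinite). -/
def Aut.order (g : Aut V) : ℕ := orderOf g.toEquiv

/-- The eigenspace `V^r` of `g`, for the eigenvalue `exp(2πi r/T)`. -/
def Aut.eig (g : Aut V) (r : ℕ) : Submodule ℂ V :=
  Module.End.eigenspace (g.toEquiv : V →ₗ[ℂ] V)
    (Complex.exp (2 * Real.pi * Complex.I * (r / g.order)))

/-- The fixed-point subspace `V^0`. -/
abbrev Aut.fixed (g : Aut V) : Submodule ℂ V := g.eig 0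

theorem Aut.mem_fixed (g : Aut V) (a : V) : a ∈ g.fixed ↔ g.toEquiv a = a := by
  simp [Aut.fixed, Aut.eig]

theorem Aut.mode_mem_fixed (g : Aut V) {a b : V} (ha : a ∈ g.fixed) (hb : b ∈ g.fixed) (n : ℤ) :
    mode VOA.Y a n b ∈ g.fixed := by
  rw [Aut.mem_fixed] at *
  rw [g.map_mode, ha, hb]

/-- The restriction of the state-field correspondence to `V^0`. -/
def Aut.fixedY (g : Aut V) : g.fixed →ₗ[ℂ] VertexOperator ℂ g.fixed where
  toFun a := HVertexOperator.of_coeff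
    (fun n => (HVertexOperator.coeff (VOA.Y (a : V)) n).restrict (p := g.fixed) (q := g.fixed)
      (fun b hb => by
        rw [VertexOperator.coeff_eq_ncoeff]
        exact g.mode_mem_fixed a.2 hb (-n - 1)))
    (fun b => (HVertexOperator.coeff_isPWOsupport (VOA.Y (a : V)) (b : V)).mono (by
      intro n hn h0
      apply hn
      exact Subtype.ext h0))
  map_add' a b := by
    apply HVertexOperator.coeff_inj
    funext n
    apply LinearMap.ext
    intro x
    apply Subtype.ext
    exact congrArg (fun A => HVertexOperator.coeff A n (x : V))
      (map_add (VOA.Y (V := V)) (a : V) (b : V))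
  map_smul' c a := by
    apply HVertexOperator.coeff_inj
    funext n
    apply LinearMap.ext
    intro x
    apply Subtype.ext
    exact congrArg (fun A => HVertexOperator.coeff A n (x : V))
      (map_smul (VOA.Y (V := V)) c (a : V))

theorem Aut.coe_fixedY (g : Aut V) (a b : g.fixed) (n : ℤ) :
    ((mode g.fixedY a n b : g.fixed) : V) = mode VOA.Y (a : V) n (b : V) := rfl

theorem Aut.fixedY_jacobi (g : Aut V) : JacobiIdentity g.fixedY g.fixedY := by
  intro a b x l m n
  have key : ∀ f : ℕ → g.fixed, ((∑ᶠ i, f i : g.fixed) : V) = ∑ᶠ i, (f i : V) := fun f =>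
    (g.fixed.subtype.toAddMonoidHom).map_finsum_of_injective Subtype.val_injective f
  apply Subtype.ext
  rw [Submodule.coe_sub, key, key, key]
  exact VOA.jacobi (a : V) (b : V) (x : V) l m n

theorem Aut.grading_fixed (g : Aut V) (o : g.fixed) (ho : (o : V) = VOA.omega) :
    DirectSum.IsInternal
      (fun n : ℤ => Module.End.eigenspace (mode g.fixedY o 1) (n : ℂ)) := by
  apply DirectSum.isInternal_submodule_of_iSupIndep_of_iSup_eq_top
  · exact (Module.End.eigenspaces_iSupIndep (mode g.fixedY o 1)).comp Int.cast_injective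
  · rw [eq_top_iff]
    rintro ⟨x, hx⟩ -
    have hind := (VOA.grading (V := V)).submodule_iSupIndep
    have htop := (VOA.grading (V := V)).submodule_iSup_eq_top
    have hxt : x ∈ ⨆ n : ℤ, Module.End.eigenspace (mode (VOA.Y (V := V)) VOA.omega 1) (n : ℂ) :=
      htop ▸ Submodule.mem_top
    obtain ⟨f, hf, rfl⟩ := (Submodule.mem_iSup_iff_exists_finsupp _ _).1 hxt
    have hgf : ∀ n : ℤ, g.toEquiv (f n) ∈
        Module.End.eigenspace (mode (VOA.Y (V := V)) VOA.omega 1) (n : ℂ) := by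
      intro n
      have h1 := Module.End.mem_eigenspace_iff.1 (hf n)
      rw [Module.End.mem_eigenspace_iff]
      have h2 := g.map_mode VOA.omega (f n) 1
      rw [g.map_omega, h1, map_smul] at h2
      exact h2.symm
    have hfix : ∀ n ∈ f.support, g.toEquiv (f n) = f n := by
      refine (iSupIndep_iff_finsetSum_eq_imp_eq _).1 hind f.support _ _
        (fun n _ => ⟨hgf n, hf n⟩) ?_
      have := (g.mem_fixed _).1 hx
      rw [Finsupp.sum, map_sum] at this
      exact this
    have hx' : (⟨f.sum fun _ x => x, hx⟩ : g.fixed) =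
        ∑ n ∈ f.support.attach, ⟨f n, (g.mem_fixed _).2 (hfix n n.2)⟩ := by
      apply Subtype.ext
      rw [Submodule.coe_sum]
      exact (Finset.sum_attach f.support (fun n => f n)).symm
    rw [hx']
    refine Submodule.sum_mem _ fun n _ => Submodule.mem_iSup_of_mem (n : ℤ) ?_
    rw [Module.End.mem_eigenspace_iff]
    apply Subtype.ext
    rw [g.coe_fixedY, ho]
    exact Module.End.mem_eigenspace_iff.1 (hf n)

theorem Aut.mem_eigenspace_fixed (g : Aut V) (o : g.fixed) (ho : (o : V) = VOA.omega) (n : ℤ)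
    (x : g.fixed) : x ∈ Module.End.eigenspace (mode g.fixedY o 1) (n : ℂ) ↔
      (x : V) ∈ Module.End.eigenspace (mode (VOA.Y (V := V)) VOA.omega 1) (n : ℂ) := by
  rw [Module.End.mem_eigenspace_iff, Module.End.mem_eigenspace_iff, Subtype.ext_iff,
    g.coe_fixedY, ho, Submodule.coe_smul]

theorem Aut.finite_fixed (g : Aut V) (o : g.fixed) (ho : (o : V) = VOA.omega) (n : ℤ) :
    FiniteDimensional ℂ (Module.End.eigenspace (mode g.fixedY o 1) (n : ℂ)) := by
  have hfin := VOA.finite_weight (V := V) n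
  have hle : (Module.End.eigenspace (mode g.fixedY o 1) (n : ℂ)).map g.fixed.subtype ≤
      Module.End.eigenspace (mode (VOA.Y (V := V)) VOA.omega 1) (n : ℂ) := by
    rintro _ ⟨x, hx, rfl⟩
    exact (g.mem_eigenspace_fixed o ho n x).1 hx
  have hfin' := Submodule.finiteDimensional_of_le hle
  exact (Submodule.equivMapOfInjective g.fixed.subtype Subtype.val_injective
    (Module.End.eigenspace (mode g.fixedY o 1) (n : ℂ))).symm.finiteDimensional

theorem Aut.bounded_fixed (g : Aut V) (o : g.fixed) (ho : (o : V) = VOA.omega) :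
    ∃ N : ℤ, ∀ n < N, Module.End.eigenspace (mode g.fixedY o 1) (n : ℂ) = ⊥ := by
  obtain ⟨N, hN⟩ := VOA.bounded_below (V := V)
  refine ⟨N, fun n hn => ?_⟩
  rw [eq_bot_iff]
  intro x hx
  have h1 := (g.mem_eigenspace_fixed o ho n x).1 hx
  rw [hN n hn, Submodule.mem_bot] at h1
  exact (Submodule.mem_bot ℂ).2 (Subtype.ext h1)

theorem Aut.virasoro_fixed (g : Aut V) (o : g.fixed) (ho : (o : V) = VOA.omega) (m n : ℤ)
    (x : g.fixed) :
    mode g.fixedY o (m + 1) (mode g.fixedY o (n + 1) x) -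
        mode g.fixedY o (n + 1) (mode g.fixedY o (m + 1) x) =
      ((m : ℂ) - n) • mode g.fixedY o (m + n + 1) x +
        (if m + n = 0 then (((m : ℂ) ^ 3 - m) / 12 * VOA.charge V) • x else 0) := by
  apply Subtype.ext
  have h := VOA.virasoro m n (x : V)
  rw [Submodule.coe_sub, Submodule.coe_add, Submodule.coe_smul, g.coe_fixedY, g.coe_fixedY,
    g.coe_fixedY, g.coe_fixedY, g.coe_fixedY, ho, h]
  split_ifs <;> simp

theorem Aut.derivative_fixed (g : Aut V) (o : g.fixed) (ho : (o : V) = VOA.omega) (a : g.fixed)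
    (n : ℤ) : mode g.fixedY (mode g.fixedY o 0 a) n = (-n : ℂ) • mode g.fixedY a (n - 1) := by
  apply LinearMap.ext
  intro x
  apply Subtype.ext
  have h := DFunLike.congr_fun (VOA.derivative (a : V) n) (x : V)
  rw [g.coe_fixedY, g.coe_fixedY, ho, h, LinearMap.smul_apply, LinearMap.smul_apply,
    Submodule.coe_smul, g.coe_fixedY]

theorem Aut.vac_fixed (g : Aut V) (e : g.fixed) (he : (e : V) = VOA.vac) (n : ℤ) :
    mode g.fixedY e n = if n = -1 then 1 else 0 := by
  apply LinearMap.ext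
  intro x
  apply Subtype.ext
  rw [g.coe_fixedY, he, VOA.vac_mode]
  split_ifs <;> rfl

theorem Aut.creation_fixed (g : Aut V) (e : g.fixed) (he : (e : V) = VOA.vac) (a : g.fixed) :
    mode g.fixedY a (-1) e = a ∧ ∀ n : ℤ, 0 ≤ n → mode g.fixedY a n e = 0 := by
  constructor
  · apply Subtype.ext
    rw [g.coe_fixedY, he, (VOA.creation (a : V)).1]
  · intro n hn
    apply Subtype.ext
    rw [g.coe_fixedY, he, (VOA.creation (a : V)).2 n hn, Submodule.coe_zero]

/-- The vertex operator algebra `V^0`, with the fields, vacuum and conformal vector of `V`. -/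
instance Aut.fixedVOA (g : Aut V) : VOA g.fixed where
  Y := g.fixedY
  vac := ⟨VOA.vac, (g.mem_fixed _).2 g.map_vac⟩
  omega := ⟨VOA.omega, (g.mem_fixed _).2 g.map_omega⟩
  charge := VOA.charge V
  vac_mode := g.vac_fixed _ rfl
  creation := g.creation_fixed _ rfl
  jacobi := g.fixedY_jacobi
  virasoro := g.virasoro_fixed _ rfl
  derivative := g.derivative_fixed _ rfl
  grading := g.grading_fixed _ rfl
  finite_weight := g.finite_fixed _ rfl
  bounded_below := g.bounded_fixed _ rfl

end Automorphisms

section Zhu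

variable {V : Type u} [AddCommGroup V] [Module ℂ V] [VOA V]

/-- The subspace `V^r_n` of vectors of weight `n` in `V^r`. -/
def Aut.homog (g : Aut V) (r : ℕ) (n : ℤ) : Submodule ℂ V := g.eig r ⊓ wtSpace V n

/-- `δ(r) = 1` if `r = 0`, and `δ(r) = 0` otherwise. -/
def delta (r : ℕ) : ℕ := if r = 0 then 1 else 0

section Products

variable {M : Type v} [AddCommGroup M] [Module ℂ M] [WeakModule V M]

/-- `Res_z (1 + z)^p z^(-k) Y_M(a, z) x = ∑ⱼ C(p,j) a_(j-k) x` (a finite sum). -/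
def res (p : ℂ) (k : ℤ) (a : V) (x : M) : M := ∑ᶠ j : ℕ, Ring.choose p j • act a (j - k) x

/-- The product `a ∘_g x`, for `a ∈ V^r_n`. -/
def Aut.circ (g : Aut V) (r : ℕ) (n : ℤ) (a : V) (x : M) : M :=
  res ((n : ℂ) - 1 + delta r + (r : ℂ) / g.order) (1 + delta r) a x

/-- The product `a ∗_g x`, for `a ∈ V^r_n`. -/
def leftStar (r : ℕ) (n : ℤ) (a : V) (x : M) : M := if r = 0 then res (n : ℂ) 1 a x else 0

/-- The product `x ∗_g a`, for `a ∈ V^r_n`. -/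
def rightStar (r : ℕ) (n : ℤ) (a : V) (x : M) : M := if r = 0 then res ((n : ℂ) - 1) 1 a x else 0

end Products

/-- The set of all `a ∘_g x` with `a ∈ V` homogeneous in some `V^r`, `0 ≤ r < T`, and `x ∈ M`. -/
def circSet (g : Aut V) (M : Type v) [AddCommGroup M] [Module ℂ M] [WeakModule V M] : Set M :=
  {y | ∃ (r : ℕ) (n : ℤ) (a : V) (x : M), r < g.order ∧ a ∈ g.homog r n ∧ y = g.circ r n a x}

/-- `O_g(V)`, the span of the `a ∘_g b`. -/
def zhuO (g : Aut V) : Submodule ℂ V := Submodule.span ℂ (circSet g V)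

/-- `O_{g,lam}(M)`, the span of the `a ∘_g x` and the `L(-1) x + (L(0) + lam) x`. -/
def modO (g : Aut V) (M : Type v) [AddCommGroup M] [Module ℂ M] [WeakModule V M] (lam : ℂ) :
    Submodule ℂ M :=
  Submodule.span ℂ (circSet g M ∪ {y | ∃ x : M, y = Lm1 V M x + (L0 V M x + lam • x)})

/-- `B_{g,lam}(M) = M / O_{g,lam}(M)`. -/
abbrev BQuot (g : Aut V) (M : Type v) [AddCommGroup M] [Module ℂ M] [WeakModule V M] (lam : ℂ) :
    Type v :=
  M ⧸ modO g M lam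

/-- The class of `x ∈ M` in `B_{g,lam}(M)`. -/
abbrev BQuot.of (g : Aut V) {M : Type v} [AddCommGroup M] [Module ℂ M] [WeakModule V M] (lam : ℂ)
    (x : M) : BQuot g M lam :=
  (modO g M lam).mkQ x

/-- The structure of an associative algebra on `V / O_g(V)` with identity `[𝟙]` and with product
induced by `∗_g`. There is at most one, since `V` is spanned by the `V^r_n`. -/
structure ZhuProduct (g : Aut V) where
  /-- The product. -/
  mul : (V ⧸ zhuO g) →ₗ[ℂ] (V ⧸ zhuO g) →ₗ[ℂ] (V ⧸ zhuO g)
  mul_mk : ∀ (r : ℕ) (n : ℤ) (a b : V), r < g.order → a ∈ g.homog r n →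
    mul ((zhuO g).mkQ a) ((zhuO g).mkQ b) = (zhuO g).mkQ (leftStar r n a b)
  mul_assoc : ∀ x y z, mul (mul x y) z = mul x (mul y z)
  one_mul : ∀ x, mul ((zhuO g).mkQ VOA.vac) x = x
  mul_one : ∀ x, mul x ((zhuO g).mkQ VOA.vac) = x

/-- The `g`-twisted Zhu algebra `A_g(V) = V / O_g(V)`, with its product induced by `∗_g`. -/
def ZhuAlgebra {g : Aut V} (_P : ZhuProduct g) : Type u := V ⧸ zhuO g

namespace ZhuAlgebra

variable {g : Aut V} (P : ZhuProduct g)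

instance : AddCommGroup (ZhuAlgebra P) := inferInstanceAs (AddCommGroup (V ⧸ zhuO g))

instance : Module ℂ (ZhuAlgebra P) := inferInstanceAs (Module ℂ (V ⧸ zhuO g))

/-- The class `[a]` of `a ∈ V` in `A_g(V)`. -/
def of : V →ₗ[ℂ] ZhuAlgebra P := (zhuO g).mkQ

instance : Ring (ZhuAlgebra P) :=
  { (inferInstance : AddCommGroup (ZhuAlgebra P)) with
    mul := fun x y => P.mul x y
    one := of P VOA.vac
    mul_assoc := P.mul_assoc
    one_mul := P.one_mul
    mul_one := P.mul_one
    left_distrib := fun x y z => map_add (P.mul x) y z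
    right_distrib := fun x y z => P.mul.map_add₂ x y z
    zero_mul := fun x => P.mul.map_zero₂ x
    mul_zero := fun x => map_zero (P.mul x) }

instance : Algebra ℂ (ZhuAlgebra P) :=
  Algebra.ofModule (fun c x y => P.mul.map_smul₂ c x y) (fun c x y => map_smul (P.mul x) c y)

end ZhuAlgebra

end Zhu

section Tensor

/-- The relations defining `U³ ⊗_A B ⊗_A U²` as a quotient of `U³ ⊗ B ⊗ U²`, for a right module
`U³`, a bimodule `B` and a left module `U²` over the `ℂ`-algebra `A`. -/
def tensorRel (A : Type*) [Ring A] (U3 B U2 : Type*)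
    [AddCommGroup U3] [Module ℂ U3] [Module Aᵐᵒᵖ U3]
    [AddCommGroup B] [Module ℂ B] [Module A B] [Module Aᵐᵒᵖ B]
    [AddCommGroup U2] [Module ℂ U2] [Module A U2] : Submodule ℂ ((U3 ⊗[ℂ] B) ⊗[ℂ] U2) :=
  Submodule.span ℂ
    ({y | ∃ (a : A) (u3 : U3) (b : B) (u2 : U2),
        y = ((MulOpposite.op a • u3) ⊗ₜ[ℂ] b) ⊗ₜ[ℂ] u2 - (u3 ⊗ₜ[ℂ] (a • b)) ⊗ₜ[ℂ] u2} ∪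
     {y | ∃ (a : A) (u3 : U3) (b : B) (u2 : U2),
        y = (u3 ⊗ₜ[ℂ] (MulOpposite.op a • b)) ⊗ₜ[ℂ] u2 - (u3 ⊗ₜ[ℂ] b) ⊗ₜ[ℂ] (a • u2)})

/-- The tensor product `U³ ⊗_A B ⊗_A U²`. -/
abbrev TripleTensor (A : Type*) [Ring A] (U3 B U2 : Type*)
    [AddCommGroup U3] [Module ℂ U3] [Module Aᵐᵒᵖ U3]
    [AddCommGroup B] [Module ℂ B] [Module A B] [Module Aᵐᵒᵖ B]
    [AddCommGroup U2] [Module ℂ U2] [Module A U2] : Type _ :=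
  ((U3 ⊗[ℂ] B) ⊗[ℂ] U2) ⧸ tensorRel A U3 B U2

/-- The relations defining `U³ ⊗_S B ⊗_S U²`, where `A`-modules are regarded as `S`-modules by
restriction along `φ : S → A`. -/
def tensorRelVia {S A : Type*} [Ring S] [Ring A] (φ : S →+* A) (U3 B U2 : Type*)
    [AddCommGroup U3] [Module ℂ U3] [Module Aᵐᵒᵖ U3]
    [AddCommGroup B] [Module ℂ B] [Module A B] [Module Aᵐᵒᵖ B]
    [AddCommGroup U2] [Module ℂ U2] [Module A U2] : Submodule ℂ ((U3 ⊗[ℂ] B) ⊗[ℂ] U2) :=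
  letI : Module Sᵐᵒᵖ U3 := Module.compHom U3 (RingHom.op φ)
  letI : Module S B := Module.compHom B φ
  letI : Module Sᵐᵒᵖ B := Module.compHom B (RingHom.op φ)
  letI : Module S U2 := Module.compHom U2 φ
  tensorRel S U3 B U2

/-- The tensor product `U³ ⊗_S B ⊗_S U²`, where `A`-modules are regarded as `S`-modules by
restriction along `φ : S → A`. -/
abbrev TripleTensorVia {S A : Type*} [Ring S] [Ring A] (φ : S →+* A) (U3 B U2 : Type*)
    [AddCommGroup U3] [Module ℂ U3] [Module Aᵐᵒᵖ U3]
    [AddCommGroup B] [Module ℂ B] [Module A B] [Module Aᵐᵒᵖ B]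
    [AddCommGroup U2] [Module ℂ U2] [Module A U2] : Type _ :=
  ((U3 ⊗[ℂ] B) ⊗[ℂ] U2) ⧸ tensorRelVia φ U3 B U2

end Tensor

section Coinvariants

variable {V : Type u} [AddCommGroup V] [Module ℂ V] [VOA V] {g : Aut V}

/-- The subspace `J` of `U³ ⊗ M ⊗ U²`, with `h = h₁ + h₂ - h₃`, spanned by
* `u₃ ⊗ (L(-1) + L(0) - h₁ + h) x ⊗ u₂`;
* `u₃·[a] ⊗ x ⊗ u₂ - ∑ⱼ C(wt a, j) u₃ ⊗ a_(j-1) x ⊗ u₂`, for `a ∈ V^0` homogeneous;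
* `u₃ ⊗ x ⊗ [a]·u₂ - ∑ⱼ C(wt a - 1, j) u₃ ⊗ a_(j-1) x ⊗ u₂`, for `a ∈ V^0` homogeneous;
* `∑ⱼ C(wt a - 1 + r/T, j) u₃ ⊗ a_(j-1) x ⊗ u₂`, for `a ∈ V^r` homogeneous, `0 < r < T`. -/
def coinvJ (P : ZhuProduct g) (h1 h2 h3 : ℂ) (U3 M U2 : Type*)
    [AddCommGroup U3] [Module ℂ U3] [Module (ZhuAlgebra P)ᵐᵒᵖ U3]
    [AddCommGroup M] [Module ℂ M] [WeakModule V M]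
    [AddCommGroup U2] [Module ℂ U2] [Module (ZhuAlgebra P) U2] :
    Submodule ℂ ((U3 ⊗[ℂ] M) ⊗[ℂ] U2) :=
  Submodule.span ℂ
    ({y | ∃ (u3 : U3) (x : M) (u2 : U2),
        y = (u3 ⊗ₜ[ℂ] (Lm1 V M x + L0 V M x - h1 • x + (h1 + h2 - h3) • x)) ⊗ₜ[ℂ] u2} ∪
     {y | ∃ (u3 : U3) (x : M) (u2 : U2) (n : ℤ) (a : V), a ∈ g.homog 0 n ∧
        y = ((MulOpposite.op (ZhuAlgebra.of P a) • u3) ⊗ₜ[ℂ] x) ⊗ₜ[ℂ] u2 -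
          (u3 ⊗ₜ[ℂ] res (n : ℂ) 1 a x) ⊗ₜ[ℂ] u2} ∪
     {y | ∃ (u3 : U3) (x : M) (u2 : U2) (n : ℤ) (a : V), a ∈ g.homog 0 n ∧
        y = (u3 ⊗ₜ[ℂ] x) ⊗ₜ[ℂ] (ZhuAlgebra.of P a • u2) -
          (u3 ⊗ₜ[ℂ] res ((n : ℂ) - 1) 1 a x) ⊗ₜ[ℂ] u2} ∪
     {y | ∃ (u3 : U3) (x : M) (u2 : U2) (r : ℕ) (n : ℤ) (a : V), r ≠ 0 ∧ r < g.order ∧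
        a ∈ g.homog r n ∧
        y = (u3 ⊗ₜ[ℂ] res ((n : ℂ) - 1 + (r : ℂ) / g.order) 1 a x) ⊗ₜ[ℂ] u2})

/-- The space `(U³ ⊗ M ⊗ U²) / J` of `g`-twisted restricted coinvariants. -/
abbrev Coinvariants (P : ZhuProduct g) (h1 h2 h3 : ℂ) (U3 M U2 : Type*)
    [AddCommGroup U3] [Module ℂ U3] [Module (ZhuAlgebra P)ᵐᵒᵖ U3]
    [AddCommGroup M] [Module ℂ M] [WeakModule V M]
    [AddCommGroup U2] [Module ℂ U2] [Module (ZhuAlgebra P) U2] : Type _ :=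
  ((U3 ⊗[ℂ] M) ⊗[ℂ] U2) ⧸ coinvJ P h1 h2 h3 U3 M U2

end Coinvariants

end TwistedZhu

end

open TwistedZhu

/-! All the products are residues Res (1+z)^p z^k Y(a,z)x, so each congruence reduces to deciding
which exponents give elements of the span `circO` of the a ∘_g x. The basic criterion is
`resid_mem_circO`: for a ∈ V^r of weight n, the exponents p = n-1+δ(r)+r/T+k and pole order 1+δ(r)+m
give an element of the span whenever k ≤ m. It follows from integration by parts applied to L(-1)a.

The Jacobi identity, paired with arbitrary Laurent series f(z₁)h(z₂) (`jacobi_resid`), turns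
commutators and iterates of residues into sums of residues, to which the criterion applies. This
gives modulo `circO`: both multiplications by a preserve the span (`star_mem_circO`), elements of
O_g(V) act by zero (`star_zhuO_mem_circO`), left and right multiplications commute
(`star_comm_mem_circO`), and both are associative (`star_one_assoc_mem_circO`,
`star_zero_assoc_mem_circO`). The commutator of either multiplication with L(-1)+L(0) is a ∘_g x
itself (`commutator_omega_star_mem`), so both also descend to B_{g,λ}(M). Taking M = V gives the
algebra A_g(V).

For r ≠ 0 one has a ∘_g 𝟙 = a, so V^r dies in A_g(V) and A(V^0) maps onto it.

For the coinvariants, λ = h - h₁, and the generators of J are the relations of O_{g,λ}(M) and the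
two balancing relations, except that a ∘_g x with a ∈ V^0 is not listed. It lies in J all the same:
it equals (L(-1)a + (wt a)a) ∗_g x, which the left balancing relation exchanges for the action on U³
of the class [L(-1)a + (wt a)a] = 0 (`circ_mem_coinvJ`). Hence the two quotients agree. Balancing
over A(V^0) instead of A_g(V) gives the same relations because the map between them is onto. -/

noncomputable section

namespace TwistedZhu

universe u v w

/-! ### Laurent expansions of (1+z)^p z^k and reduction to monomials. -/

section Laurent

/-- The Laurent series `(1 + z)^p z^k`. -/
def binomialLaurent (p : ℂ) (k : ℤ) : LaurentSeries ℂ :=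
  HahnSeries.single k 1 * HahnSeries.ofPowerSeries ℤ ℂ (PowerSeries.binomialSeries ℂ p)

theorem coeff_binomialLaurent_add (p : ℂ) (k : ℤ) (j : ℕ) :
    (binomialLaurent p k).coeff (k + j) = Ring.choose p j := by
  rw [binomialLaurent, HahnSeries.coeff_single_mul, add_sub_cancel_left,
    HahnSeries.ofPowerSeries_apply_coeff]
  simp

theorem coeff_binomialLaurent_of_lt (p : ℂ) {k n : ℤ} (h : n < k) :
    (binomialLaurent p k).coeff n = 0 := by
  rw [binomialLaurent, HahnSeries.coeff_single_mul, PowerSeries.coeff_coe, if_pos (by omega),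
    mul_zero]

theorem single_mul_binomialLaurent (i : ℤ) (p : ℂ) (k : ℤ) :
    HahnSeries.single i 1 * binomialLaurent p k = binomialLaurent p (i + k) := by
  rw [binomialLaurent, binomialLaurent, ← mul_assoc, HahnSeries.single_mul_single, one_mul]

theorem binomialLaurent_mul (p q : ℂ) (k l : ℤ) :
    binomialLaurent p k * binomialLaurent q l = binomialLaurent (p + q) (k + l) := by
  rw [binomialLaurent, binomialLaurent, binomialLaurent, PowerSeries.binomialSeries_add, map_mul,
    ← one_mul (1 : ℂ), ← HahnSeries.single_mul_single]
  simp only [one_mul]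
  ring

theorem binomialLaurent_one : binomialLaurent 1 0 = 1 + HahnSeries.single 1 1 := by
  have := PowerSeries.binomialSeries_nat (R := ℂ) (A := ℂ) 1
  rw [Nat.cast_one, pow_one] at this
  rw [binomialLaurent, this, map_add, (HahnSeries.ofPowerSeries ℤ ℂ).map_one, HahnSeries.ofPowerSeries_X]
  change (1 : LaurentSeries ℂ) * _ = _
  rw [one_mul]

theorem binomialLaurent_add_one (p : ℂ) (k : ℤ) :
    binomialLaurent (p + 1) k = binomialLaurent p k + binomialLaurent p (k + 1) := by
  have h := binomialLaurent_mul 1 p 0 k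
  rw [binomialLaurent_one, add_mul, one_mul, single_mul_binomialLaurent, zero_add] at h
  rw [add_comm p, ← h, add_comm 1 k]

/-- Leibniz rule for divided derivatives. On coefficients it is the Chu–Vandermonde identity
combined with C(p,q)C(q,i) = C(p,i)C(p-i,q-i). -/
theorem hasseDeriv_binomialLaurent (j : ℕ) (p : ℂ) (k : ℤ) :
    LaurentSeries.hasseDeriv ℂ j (binomialLaurent p k) =
      ∑ ij ∈ Finset.HasAntidiagonal.antidiagonal j, (Ring.choose p ij.1 * (Ring.choose k ij.2 : ℤ)) •
        binomialLaurent (p - ij.1) (k - ij.2) := by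
  ext n
  rw [LaurentSeries.hasseDeriv_coeff, HahnSeries.coeff_sum]
  simp only [HahnSeries.coeff_smul, smul_eq_mul, zsmul_eq_mul]
  rcases lt_or_ge (n + j) k with h | h
  · rw [coeff_binomialLaurent_of_lt _ h, mul_zero]
    refine (Finset.sum_eq_zero fun ij hij => ?_).symm
    rw [Finset.HasAntidiagonal.mem_antidiagonal] at hij
    rw [coeff_binomialLaurent_of_lt _ (by omega), mul_zero]
  · obtain ⟨q, hq⟩ := Int.le.dest h
    rw [← hq, coeff_binomialLaurent_add, add_comm k, Ring.add_choose_eq _ (Commute.all _ _),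
      Int.cast_sum, Finset.sum_mul]
    refine Finset.sum_congr rfl fun ij hij => ?_
    rw [Finset.HasAntidiagonal.mem_antidiagonal] at hij
    rw [Ring.choose_natCast]
    push_cast
    rcases le_or_gt ij.1 q with hi | hi
    · obtain ⟨m, rfl⟩ := Nat.exists_eq_add_of_le hi
      have h1 := Ring.choose_smul_choose p hi
      rw [nsmul_eq_mul, Nat.add_sub_cancel_left] at h1
      rw [show n = k - ij.2 + m by push_cast at hq; omega, coeff_binomialLaurent_add]
      linear_combination ((Ring.choose k ij.2 : ℤ) : ℂ) * h1
    · rw [Nat.choose_eq_zero_of_lt hi, coeff_binomialLaurent_of_lt _ (by omega)]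
      simp

theorem hasseDeriv_one_binomialLaurent (p : ℂ) (k : ℤ) :
    LaurentSeries.hasseDeriv ℂ 1 (binomialLaurent p k) =
      p • binomialLaurent (p - 1) k + (k : ℂ) • binomialLaurent p (k - 1) := by
  rw [hasseDeriv_binomialLaurent]
  rw [show (Finset.HasAntidiagonal.antidiagonal 1 : Finset (ℕ × ℕ)) = {(0, 1), (1, 0)} from rfl,
    Finset.sum_pair (by decide)]
  simp [add_comm]

/-- A Laurent series is a finite sum of monomials plus a tail of high order. -/
theorem exists_laurent_tail (K N : ℤ) (f : LaurentSeries ℂ) (hf : ∀ n < K, f.coeff n = 0) :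
    ∃ t : LaurentSeries ℂ, (∀ n < N, t.coeff n = 0) ∧ (∀ n < K, t.coeff n = 0) ∧
      f = ∑ n ∈ Finset.Ico K N, f.coeff n • HahnSeries.single n 1 + t := by
  have hc : ∀ m, (∑ n ∈ Finset.Ico K N, f.coeff n • HahnSeries.single n (1 : ℂ)).coeff m =
      if m ∈ Finset.Ico K N then f.coeff m else 0 := by
    intro m
    rw [HahnSeries.coeff_sum]
    simp only [HahnSeries.coeff_smul, HahnSeries.coeff_single, smul_eq_mul, mul_ite, mul_one,
      mul_zero]
    rw [Finset.sum_ite_eq]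
  refine ⟨f - ∑ n ∈ Finset.Ico K N, f.coeff n • HahnSeries.single n 1, fun n hn => ?_,
    fun n hn => ?_, (add_sub_cancel _ _).symm⟩
  · rw [HahnSeries.coeff_sub, hc]
    split_ifs with h
    · exact sub_self _
    · rw [Finset.mem_Ico] at h
      rw [hf n (by omega), sub_zero]
  · rw [HahnSeries.coeff_sub, hc, hf n hn]
    simp

/-- A linear map which vanishes on monomials and on all Laurent series of high order vanishes. -/
theorem laurent_eq_zero {N : Type*} [AddCommGroup N] [Module ℂ N] (Φ : LaurentSeries ℂ →ₗ[ℂ] N)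
    (K B : ℤ) (hB : ∀ f : LaurentSeries ℂ, (∀ n < B, f.coeff n = 0) → Φ f = 0)
    (hs : ∀ n, K ≤ n → Φ (HahnSeries.single n 1) = 0) (f : LaurentSeries ℂ)
    (hf : ∀ n < K, f.coeff n = 0) : Φ f = 0 := by
  obtain ⟨t, ht, -, h⟩ := exists_laurent_tail K B f hf
  rw [h, map_add, hB t ht, add_zero, map_sum]
  refine Finset.sum_eq_zero fun n hn => ?_
  rw [map_smul, hs n (Finset.mem_Ico.1 hn).1, smul_zero]

theorem exists_coeff_eq_zero_of_lt (f : LaurentSeries ℂ) : ∃ K : ℤ, ∀ n < K, f.coeff n = 0 :=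
  ⟨f.order, fun _ h => HahnSeries.coeff_eq_zero_of_lt_order h⟩

theorem laurent_mul_smul (c : ℂ) (f h : LaurentSeries ℂ) : f * (c • h) = c • (f * h) := by
  rw [← HahnSeries.C_mul_eq_smul, ← HahnSeries.C_mul_eq_smul, mul_left_comm]

theorem laurent_smul_mul (c : ℂ) (f h : LaurentSeries ℂ) : (c • f) * h = c • (f * h) := by
  rw [← HahnSeries.C_mul_eq_smul, ← HahnSeries.C_mul_eq_smul, mul_assoc]

/-- The coefficients of `f` vanish below degree `B`. -/
def SuppGE (B : ℤ) (f : LaurentSeries ℂ) : Prop := ∀ n < B, f.coeff n = 0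

theorem SuppGE.mono {A B : ℤ} {f : LaurentSeries ℂ} (h : SuppGE B f) (hAB : A ≤ B) : SuppGE A f :=
  fun n hn => h n (by omega)

theorem SuppGE.single_mul {B : ℤ} {f : LaurentSeries ℂ} (h : SuppGE B f) (i : ℤ) :
    SuppGE (i + B) (HahnSeries.single i 1 * f) := by
  intro n hn
  rw [HahnSeries.coeff_single_mul, h _ (by omega), mul_zero]

theorem SuppGE.mul {A B : ℤ} {f h : LaurentSeries ℂ} (hf : SuppGE A f) (hh : SuppGE B h) :
    SuppGE (A + B) (f * h) := by
  intro n hn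
  rw [HahnSeries.coeff_mul]
  refine Finset.sum_eq_zero fun ij hij => ?_
  have := (Finset.mem_antidiagonal.1 hij).2.2
  rcases lt_or_ge ij.1 A with h1 | h1
  · rw [hf _ h1, zero_mul]
  · rw [hh _ (by omega), mul_zero]

theorem SuppGE.hasseDeriv {B : ℤ} {f : LaurentSeries ℂ} (h : SuppGE B f) (j : ℕ) :
    SuppGE (B - j) (LaurentSeries.hasseDeriv ℂ j f) := by
  intro n hn
  rw [LaurentSeries.hasseDeriv_coeff, h _ (by omega), smul_zero]

theorem suppGE_binomialLaurent (p : ℂ) (k : ℤ) : SuppGE k (binomialLaurent p k) :=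
  fun _ hn => coeff_binomialLaurent_of_lt p hn

end Laurent

/-! ### Residues of fields and the Jacobi identity against arbitrary Laurent series. -/

section Residue

variable {V : Type u} [AddCommGroup V] [Module ℂ V] [VOA V]
variable {M : Type v} [AddCommGroup M] [Module ℂ M] [WeakModule V M]

theorem exists_act_eq_zero (a : V) (x : M) : ∃ B : ℤ, ∀ n, B ≤ n → act a n x = 0 := by
  refine ⟨-((HahnModule.of ℂ).symm ((WeakModule.YM (V := V) (M := M) a) x)).order, fun n hn => ?_⟩
  exact VertexOperator.ncoeff_eq_zero_of_lt_order _ n x (by omega)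

/-- A bound beyond which the modes of `a` annihilate `x`. -/
def modeBound (a : V) (x : M) : ℤ := (exists_act_eq_zero a x).choose

theorem act_eq_zero_of_le {a : V} {x : M} {n : ℤ} (h : modeBound a x ≤ n) : act a n x = 0 :=
  (exists_act_eq_zero a x).choose_spec n h

theorem act_add (a b : V) (n : ℤ) : (act (a + b) n : Module.End ℂ M) = act a n + act b n := by
  simp [act, mode]

theorem act_smul (c : ℂ) (a : V) (n : ℤ) : (act (c • a) n : Module.End ℂ M) = c • act a n := by
  simp [act, mode]

theorem act_zero (n : ℤ) : (act (0 : V) n : Module.End ℂ M) = 0 := by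
  simpa using act_smul (M := M) 0 (0 : V) n

theorem finite_support_residue (f : LaurentSeries ℂ) (a : V) (x : M) :
    (Function.support fun n : ℤ => f.coeff n • act a n x).Finite := by
  refine (Set.finite_Ico f.order (modeBound a x)).subset fun n hn => ?_
  by_contra h
  apply hn
  rw [Set.mem_Ico, not_and_or] at h
  dsimp only
  rcases h with h | h
  · rw [HahnSeries.coeff_eq_zero_of_lt_order (not_le.1 h), zero_smul]
  · rw [act_eq_zero_of_le (not_lt.1 h), smul_zero]

variable (M) in
/-- The residue `Res_z f(z) Y_M(a, z) x`, linear in all three arguments. -/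
def resid : LaurentSeries ℂ →ₗ[ℂ] V →ₗ[ℂ] Module.End ℂ M :=
  LinearMap.mk₂ ℂ
    (fun f a =>
      { toFun := fun x => ∑ᶠ n : ℤ, f.coeff n • act a n x
        map_add' := fun x y => by
          rw [← finsum_add_distrib (finite_support_residue f a x) (finite_support_residue f a y)]
          simp
        map_smul' := fun c x => by
          rw [RingHom.id_apply, smul_finsum]
          simp [smul_comm c] })
    (fun f h a => LinearMap.ext fun x => by
      simp only [LinearMap.coe_mk, AddHom.coe_mk, LinearMap.add_apply]
      rw [← finsum_add_distrib (finite_support_residue f a x) (finite_support_residue h a x)]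
      simp [add_smul])
    (fun c f a => LinearMap.ext fun x => by
      simp only [LinearMap.coe_mk, AddHom.coe_mk, LinearMap.smul_apply]
      rw [smul_finsum]
      simp [mul_smul])
    (fun f a b => LinearMap.ext fun x => by
      simp only [LinearMap.coe_mk, AddHom.coe_mk, LinearMap.add_apply]
      rw [← finsum_add_distrib (finite_support_residue f a x) (finite_support_residue f b x)]
      simp [act_add])
    (fun c f a => LinearMap.ext fun x => by
      simp only [LinearMap.coe_mk, AddHom.coe_mk, LinearMap.smul_apply]
      rw [smul_finsum]
      simp [act_smul, smul_comm c])

theorem resid_apply (f : LaurentSeries ℂ) (a : V) (x : M) :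
    resid M f a x = ∑ᶠ n : ℤ, f.coeff n • act a n x := rfl

theorem resid_single (m : ℤ) (a : V) (x : M) :
    resid M (HahnSeries.single m 1) a x = act a m x := by
  rw [resid_apply, finsum_eq_single _ m]
  · simp
  · intro n hn
    rw [HahnSeries.coeff_single_of_ne hn, zero_smul]

theorem resid_eq_zero {B : ℤ} {f : LaurentSeries ℂ} (hf : SuppGE B f) {a : V} {x : M}
    (h : modeBound a x ≤ B) : resid M f a x = 0 := by
  rw [resid_apply]
  refine finsum_eq_zero_of_forall_eq_zero fun n => ?_
  rcases lt_or_ge n B with hn | hn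
  · rw [hf n hn, zero_smul]
  · rw [act_eq_zero_of_le (by omega), smul_zero]

/-- Bridge to the products of the statement; `res` records the order of the pole, hence the sign of
k. -/
theorem resid_binomialLaurent (p : ℂ) (k : ℤ) (a : V) (x : M) :
    resid M (binomialLaurent p (-k)) a x = res p k a x := by
  rw [resid_apply, res]
  have hinj : Function.Injective fun j : ℕ => (j : ℤ) - k := fun i j h => by
    simpa using h
  have h1 : ∀ j : ℕ, Ring.choose p j • act a (j - k) x =
      (fun n : ℤ => (binomialLaurent p (-k)).coeff n • act a n x) (j - k) := by
    intro j
    have := coeff_binomialLaurent_add p (-k) j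
    rw [neg_add_eq_sub] at this
    dsimp only
    rw [this]
  rw [finsum_congr h1]
  symm
  rw [← finsum_mem_range hinj (f := fun n : ℤ =>
    (binomialLaurent p (-k)).coeff n • act a n x)]
  refine finsum_mem_inter_support_eq _ _ Set.univ ?_ |>.trans (finsum_mem_univ _)
  ext n
  simp only [Set.mem_inter_iff, Set.mem_range, Set.mem_univ, true_and, and_iff_right_iff_imp]
  intro hn
  refine ⟨(n + k).toNat, ?_⟩
  have : -k ≤ n := by
    by_contra h
    apply hn
    dsimp only
    rw [coeff_binomialLaurent_of_lt _ (by omega), zero_smul]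
  omega

theorem eventually_resid_eq_zero (g : ℤ → ℤ) (hg : Filter.Tendsto g Filter.atTop Filter.atTop)
    (a : V) (x : M) :
    ∀ᶠ B : ℤ in Filter.atTop, ∀ f : LaurentSeries ℂ, SuppGE (g B) f → resid M f a x = 0 := by
  filter_upwards [hg.eventually_ge_atTop (modeBound a x)] with B hB f hf
  exact resid_eq_zero hf hB

theorem finsum_eq_sum_range {N : Type*} [AddCommMonoid N] (f : ℕ → N) (I : ℕ)
    (h : ∀ i, I ≤ i → f i = 0) : ∑ᶠ i, f i = ∑ i ∈ Finset.range I, f i := by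
  refine finsum_eq_sum_of_support_subset f fun i hi => ?_
  rw [Finset.coe_range, Set.mem_Iio]
  by_contra hI
  exact hi (h i (not_lt.1 hI))

/-- The difference of the two sides of the Jacobi identity, with sums truncated at `I`. -/
def jacobiDefect (a b : V) (x : M) (l : ℤ) (I : ℕ) (f h : LaurentSeries ℂ) : M :=
  (∑ i ∈ Finset.range I, ((-1) ^ i * Ring.choose l i : ℤ) •
      resid M (HahnSeries.single (l - i) 1 * f) a (resid M (HahnSeries.single (i : ℤ) 1 * h) b x)) -
    (∑ i ∈ Finset.range I, ((Int.negOnePow (l + i) : ℤ) * Ring.choose l i) •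
      resid M (HahnSeries.single (l - i) 1 * h) b (resid M (HahnSeries.single (i : ℤ) 1 * f) a x)) -
    ∑ j ∈ Finset.range I, resid M (LaurentSeries.hasseDeriv ℂ j f * h) (act a (l + j) b : V) x

theorem isLinearMap_jacobiDefect_left (a b : V) (x : M) (l : ℤ) (I : ℕ) (h : LaurentSeries ℂ) :
    IsLinearMap ℂ fun f => jacobiDefect a b x l I f h where
  map_add f f' := by
    simp only [jacobiDefect, mul_add, add_mul, map_add, LinearMap.add_apply, smul_add,
      Finset.sum_add_distrib]
    abel
  map_smul c f := by
    simp only [jacobiDefect, laurent_mul_smul, laurent_smul_mul, map_smul, LinearMap.smul_apply,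
      smul_sub, Finset.smul_sum, smul_comm c]

theorem isLinearMap_jacobiDefect_right (a b : V) (x : M) (l : ℤ) (I : ℕ) (f : LaurentSeries ℂ) :
    IsLinearMap ℂ fun h => jacobiDefect a b x l I f h where
  map_add f f' := by
    simp only [jacobiDefect, mul_add, map_add, LinearMap.add_apply, smul_add,
      Finset.sum_add_distrib]
    abel
  map_smul c f := by
    simp only [jacobiDefect, laurent_mul_smul, map_smul, LinearMap.smul_apply,
      smul_sub, Finset.smul_sum, smul_comm c]

theorem tendsto_add_const_int (c : ℤ) :
    Filter.Tendsto (fun B : ℤ => c + B) Filter.atTop Filter.atTop :=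
  Filter.tendsto_atTop_add_const_left _ c Filter.tendsto_id

/-- For fixed I only finitely many residues occur, and each kills series of high order. This takes
the place of continuity in f and allows reduction to monomials. -/
theorem jacobiDefect_tail_left (a b : V) (x : M) (l : ℤ) (I : ℕ) (h : LaurentSeries ℂ) :
    ∃ B : ℤ, ∀ f, SuppGE B f → jacobiDefect a b x l I f h = 0 := by
  obtain ⟨K, hK⟩ := exists_coeff_eq_zero_of_lt h
  have e1 : ∀ᶠ B : ℤ in Filter.atTop, ∀ i ∈ Finset.range I, ∀ f, SuppGE ((l - i) + B) f →
      resid M f a (resid M (HahnSeries.single (i : ℤ) 1 * h) b x) = 0 :=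
    (Filter.eventually_all_finset _).2 fun i _ =>
      eventually_resid_eq_zero _ (tendsto_add_const_int _) _ _
  have e2 : ∀ᶠ B : ℤ in Filter.atTop, ∀ i ∈ Finset.range I, ∀ f, SuppGE (i + B) f →
      resid M f a x = 0 :=
    (Filter.eventually_all_finset _).2 fun i _ =>
      eventually_resid_eq_zero _ (tendsto_add_const_int _) _ _
  have e3 : ∀ᶠ B : ℤ in Filter.atTop, ∀ j ∈ Finset.range I, ∀ f, SuppGE ((K - j) + B) f →
      resid M f (act a (l + j) b : V) x = 0 :=
    (Filter.eventually_all_finset _).2 fun i _ =>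
      eventually_resid_eq_zero _ (tendsto_add_const_int _) _ _
  obtain ⟨B, h1, h2, h3⟩ := (e1.and (e2.and e3)).exists
  refine ⟨B, fun f hf => ?_⟩
  rw [jacobiDefect, Finset.sum_eq_zero, Finset.sum_eq_zero, Finset.sum_eq_zero, sub_zero, sub_zero]
  · intro j hj
    exact h3 j hj _ (((hf.hasseDeriv j).mul hK).mono (by omega))
  · intro i hi
    rw [h2 i hi _ (hf.single_mul _), map_zero, smul_zero]
  · intro i hi
    rw [h1 i hi _ (hf.single_mul _), smul_zero]

theorem jacobiDefect_tail_right (a b : V) (x : M) (l : ℤ) (I : ℕ) (f : LaurentSeries ℂ) :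
    ∃ B : ℤ, ∀ h, SuppGE B h → jacobiDefect a b x l I f h = 0 := by
  obtain ⟨K, hK⟩ := exists_coeff_eq_zero_of_lt f
  have e1 : ∀ᶠ B : ℤ in Filter.atTop, ∀ i ∈ Finset.range I, ∀ h, SuppGE ((l - i) + B) h →
      resid M h b (resid M (HahnSeries.single (i : ℤ) 1 * f) a x) = 0 :=
    (Filter.eventually_all_finset _).2 fun i _ =>
      eventually_resid_eq_zero _ (tendsto_add_const_int _) _ _
  have e2 : ∀ᶠ B : ℤ in Filter.atTop, ∀ i ∈ Finset.range I, ∀ h, SuppGE (i + B) h →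
      resid M h b x = 0 :=
    (Filter.eventually_all_finset _).2 fun i _ =>
      eventually_resid_eq_zero _ (tendsto_add_const_int _) _ _
  have e3 : ∀ᶠ B : ℤ in Filter.atTop, ∀ j ∈ Finset.range I, ∀ h, SuppGE ((K - j) + B) h →
      resid M h (act a (l + j) b : V) x = 0 :=
    (Filter.eventually_all_finset _).2 fun i _ =>
      eventually_resid_eq_zero _ (tendsto_add_const_int _) _ _
  obtain ⟨B, h1, h2, h3⟩ := (e1.and (e2.and e3)).exists
  refine ⟨B, fun h hh => ?_⟩
  rw [jacobiDefect, Finset.sum_eq_zero, Finset.sum_eq_zero, Finset.sum_eq_zero, sub_zero, sub_zero]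
  · intro j hj
    exact h3 j hj _ ((SuppGE.mul (SuppGE.hasseDeriv hK j) hh).mono (by omega))
  · intro i hi
    rw [h1 i hi _ (hh.single_mul _), smul_zero]
  · intro i hi
    rw [h2 i hi _ (hh.single_mul _), map_zero, smul_zero]

theorem jacobiDefect_single (a b : V) (x : M) (l : ℤ) (I : ℕ) (m n : ℤ)
    (ha : ∀ i : ℕ, I ≤ i → act a (m + i) x = 0) (hb : ∀ i : ℕ, I ≤ i → act b (n + i) x = 0)
    (hab : ∀ i : ℕ, I ≤ i → (act a (l + i) b : V) = 0) :
    jacobiDefect a b x l I (HahnSeries.single m 1) (HahnSeries.single n 1) = 0 := by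
  have J := WeakModule.jacobi (V := V) (M := M) a b x l m n
  change (∑ᶠ i : ℕ, ((-1) ^ i * Ring.choose l i : ℤ) • act a (m + l - i) (act b (n + i) x)) -
      (∑ᶠ i : ℕ, ((Int.negOnePow (l + i) : ℤ) * Ring.choose l i) •
        act b (n + l - i) (act a (m + i) x)) =
    ∑ᶠ j : ℕ, (Ring.choose m j : ℤ) • act (act a (l + j) b : V) (m + n - j) x at J
  rw [finsum_eq_sum_range _ I, finsum_eq_sum_range _ I, finsum_eq_sum_range _ I, ← sub_eq_zero] at J
  · rw [← J, jacobiDefect]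
    simp only [LaurentSeries.hasseDeriv_single, HahnSeries.single_mul_single, mul_one,
      resid_single]
    refine congrArg₂ _ (congrArg₂ _ ?_ ?_) ?_
    · refine Finset.sum_congr rfl fun i _ => ?_
      rw [show l - i + m = m + l - i by ring, add_comm n]
    · refine Finset.sum_congr rfl fun i _ => ?_
      rw [show l - i + n = n + l - i by ring, add_comm m]
    · refine Finset.sum_congr rfl fun j _ => ?_
      rw [show HahnSeries.single (m - j + n) (Ring.choose m j • (1 : ℂ)) =
        (Ring.choose m j : ℤ) • HahnSeries.single (m - j + n) (1 : ℂ) from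
          map_zsmul (HahnSeries.single.addMonoidHom (m - j + n)) _ _]
      rw [map_zsmul, LinearMap.smul_apply, LinearMap.smul_apply, resid_single,
        show m - j + n = m + n - j by ring]
  · intro i hi
    rw [hab i hi, act_zero, LinearMap.zero_apply, smul_zero]
  · intro i hi
    rw [ha i hi, map_zero, smul_zero]
  · intro i hi
    rw [hb i hi, map_zero, smul_zero]

/-- The Jacobi identity for residues against arbitrary Laurent series `f(z₁)` and `h(z₂)`. -/
theorem jacobi_resid (a b : V) (x : M) (l : ℤ) (f h : LaurentSeries ℂ) :
    ∀ᶠ I : ℕ in Filter.atTop,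
      (∑ i ∈ Finset.range I, ((-1) ^ i * Ring.choose l i : ℤ) •
        resid M (HahnSeries.single (l - i) 1 * f) a
          (resid M (HahnSeries.single (i : ℤ) 1 * h) b x)) -
      (∑ i ∈ Finset.range I, ((Int.negOnePow (l + i) : ℤ) * Ring.choose l i) •
        resid M (HahnSeries.single (l - i) 1 * h) b
          (resid M (HahnSeries.single (i : ℤ) 1 * f) a x)) =
      ∑ j ∈ Finset.range I,
        resid M (LaurentSeries.hasseDeriv ℂ j f * h) (act a (l + j) b : V) x := by
  obtain ⟨K, hK⟩ := exists_coeff_eq_zero_of_lt f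
  obtain ⟨K', hK'⟩ := exists_coeff_eq_zero_of_lt h
  have ht : Filter.Tendsto (fun i : ℕ => (i : ℤ)) Filter.atTop Filter.atTop :=
    tendsto_natCast_atTop_atTop
  -- One truncation I has to serve all monomials z₁^m z₂^n with m ≥ K and n ≥ K' at once; the three
  -- bounds depend only on K, K' and l, so the expression stays linear in f and h.
  filter_upwards [ht.eventually_ge_atTop (modeBound a x - K),
    ht.eventually_ge_atTop (modeBound b x - K'),
    ht.eventually_ge_atTop (modeBound a b - l)] with I h1 h2 h3
  rw [← sub_eq_zero]
  change jacobiDefect a b x l I f h = 0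
  obtain ⟨B, hB⟩ := jacobiDefect_tail_left a b x l I h
  refine laurent_eq_zero (isLinearMap_jacobiDefect_left a b x l I h).mk' K B hB
    (fun m hm => ?_) f hK
  obtain ⟨B', hB'⟩ := jacobiDefect_tail_right a b x l I (HahnSeries.single m 1)
  refine laurent_eq_zero (isLinearMap_jacobiDefect_right a b x l I (HahnSeries.single m 1)).mk'
    K' B' hB' (fun n hn => ?_) h hK'
  exact jacobiDefect_single a b x l I m n
    (fun i hi => act_eq_zero_of_le (by omega)) (fun i hi => act_eq_zero_of_le (by omega))
    (fun i hi => act_eq_zero_of_le (by omega))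

end Residue

/-! ### The vacuum, L(-1), L(0) and weights of modes. -/

section Modes

variable {V : Type u} [AddCommGroup V] [Module ℂ V] [VOA V]
variable {M : Type v} [AddCommGroup M] [Module ℂ M] [WeakModule V M]

/-- The commutator formula for residues. -/
theorem commutator_resid (a b : V) (x : M) (f h : LaurentSeries ℂ) :
    ∀ᶠ I : ℕ in Filter.atTop,
      resid M f a (resid M h b x) - resid M h b (resid M f a x) =
        ∑ j ∈ Finset.range I,
          resid M (LaurentSeries.hasseDeriv ℂ j f * h) (act a (j : ℤ) b : V) x := by
  filter_upwards [jacobi_resid a b x 0 f h, Filter.eventually_ge_atTop 1] with I hI h1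
  simp only [zero_add] at hI
  rw [← hI, Finset.sum_eq_single_of_mem 0 (Finset.mem_range.2 h1),
    Finset.sum_eq_single_of_mem 0 (Finset.mem_range.2 h1)]
  · simp
  · intro i _ hi
    rw [Ring.choose_zero_pos ℤ (Nat.pos_of_ne_zero hi), mul_zero, zero_smul]
  · intro i _ hi
    rw [Ring.choose_zero_pos ℤ (Nat.pos_of_ne_zero hi), mul_zero, zero_smul]

theorem act_vac (n : ℤ) (x : M) : act (VOA.vac : V) n x = if n = -1 then x else 0 := by
  have := LinearMap.congr_fun (WeakModule.vac_mode (V := V) (M := M) n) x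
  rw [act, this]
  split_ifs <;> rfl

theorem act_neg_one_vac (a : V) : (act a (-1) VOA.vac : V) = a := (VOA.creation a).1

theorem act_nonneg_vac (a : V) {n : ℤ} (hn : 0 ≤ n) : (act a n VOA.vac : V) = 0 :=
  (VOA.creation a).2 n hn

theorem Lm1_eq_act_vac (a : V) : Lm1 V V a = act a (-2) VOA.vac := by
  have h := LinearMap.congr_fun (VOA.derivative a (-1)) VOA.vac
  rw [(VOA.creation (mode VOA.Y VOA.omega 0 a)).1] at h
  simp only [Int.cast_neg, Int.cast_one, neg_neg, one_smul] at h
  exact h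

/-- The derivative property is an axiom on V only. On M it is the Jacobi identity with b = 𝟙, l =
-2: on the left only modes of 𝟙 other than 𝟙_(-1) occur, and on the right a_(-2)𝟙 = L(-1)a and
a_(-1)𝟙 = a survive. -/
theorem act_Lm1 (a : V) (n : ℤ) (x : M) :
    act (Lm1 V V a) n x = (-n : ℂ) • act a (n - 1) x := by
  have J := WeakModule.jacobi (V := V) (M := M) a VOA.vac x (-2) n 0
  change (∑ᶠ i : ℕ, ((-1) ^ i * Ring.choose (-2) i : ℤ) •
        act a (n + -2 - i) (act (VOA.vac : V) (0 + i) x)) -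
      (∑ᶠ i : ℕ, ((Int.negOnePow (-2 + i) : ℤ) * Ring.choose (-2) i) •
        act (VOA.vac : V) (0 + -2 - i) (act a (n + i) x)) =
    ∑ᶠ j : ℕ, (Ring.choose n j : ℤ) • act (act a (-2 + j) VOA.vac : V) (n + 0 - j) x at J
  rw [finsum_eq_sum_range _ 0, finsum_eq_sum_range _ 0, finsum_eq_sum_range _ 2] at J
  · rw [Finset.sum_range_zero, Finset.sum_range_zero, sub_zero, Finset.sum_range_succ,
      Finset.sum_range_one] at J
    simp only [Nat.cast_zero, add_zero, sub_zero, Nat.cast_one] at J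
    rw [show (-2 + 1 : ℤ) = -1 by norm_num, act_neg_one_vac, ← Lm1_eq_act_vac,
      Ring.choose_zero_right, one_smul, Ring.choose_one_right] at J
    rw [neg_smul, Int.cast_smul_eq_zsmul]
    exact eq_neg_of_add_eq_zero_left J.symm
  · intro j hj
    rw [act_nonneg_vac _ (by omega), act_zero, LinearMap.zero_apply, smul_zero]
  · intro i _
    rw [act_vac, if_neg (by omega), smul_zero]
  · intro i _
    rw [act_vac, if_neg (by omega), map_zero, smul_zero]

/-- Integration by parts: `Res f Y(L(-1) a, z) = - Res f' Y(a, z)`. -/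
theorem resid_Lm1 (f : LaurentSeries ℂ) (a : V) (x : M) :
    resid M f (Lm1 V V a) x = -resid M (LaurentSeries.hasseDeriv ℂ 1 f) a x := by
  rw [resid_apply, resid_apply, ← finsum_neg_distrib,
    ← finsum_comp_equiv (Equiv.addRight (1 : ℤ))]
  refine finsum_congr fun n => ?_
  rw [Equiv.coe_addRight, act_Lm1, LaurentSeries.hasseDeriv_coeff, Nat.cast_one,
    Ring.choose_one_right, add_sub_cancel_right, ← Int.cast_smul_eq_zsmul ℂ]
  simp only [smul_smul, ← neg_smul, smul_eq_mul]
  congr 1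
  ring

theorem mem_wtSpace {n : ℤ} {a : V} : a ∈ wtSpace V n ↔ L0 V V a = (n : ℂ) • a :=
  Module.End.mem_eigenspace_iff

theorem Lm1_mem_wtSpace {n : ℤ} {a : V} (ha : a ∈ wtSpace V n) : Lm1 V V a ∈ wtSpace V (n + 1) := by
  rw [mem_wtSpace] at *
  have h := VOA.virasoro (0 : ℤ) (-1) a
  change act VOA.omega (0 + 1) (act VOA.omega (-1 + 1) a : V) -
    act VOA.omega (-1 + 1) (act VOA.omega (0 + 1) a : V) = _ • act VOA.omega (0 + -1 + 1) a + _ at h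
  norm_num at h
  change L0 V V (Lm1 V V a) - Lm1 V V (L0 V V a) = Lm1 V V a at h
  rw [ha, map_smul] at h
  rw [eq_add_of_sub_eq h]
  push_cast
  rw [add_smul, one_smul, add_comm]

theorem vac_mem_wtSpace : (VOA.vac : V) ∈ wtSpace V 0 := by
  rw [mem_wtSpace, Int.cast_zero, zero_smul]
  exact act_nonneg_vac _ (by norm_num)

/-- The operator `L(-1) + L(0)` is the residue of `Y(ω, z)` against `1 + z`. -/
theorem resid_omega (x : M) :
    resid M (binomialLaurent 1 0) (VOA.omega : V) x = Lm1 V M x + L0 V M x := by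
  rw [binomialLaurent_one, map_add, LinearMap.add_apply, LinearMap.add_apply, resid_single,
    show (1 : LaurentSeries ℂ) = HahnSeries.single 0 1 from rfl, resid_single]
  rfl

theorem hasseDeriv_binomialLaurent_one_add_two (j : ℕ) :
    LaurentSeries.hasseDeriv ℂ (j + 2) (binomialLaurent 1 0) = 0 := by
  rw [binomialLaurent_one, map_add, show (1 : LaurentSeries ℂ) = HahnSeries.single 0 1 from rfl,
    LaurentSeries.hasseDeriv_single, LaurentSeries.hasseDeriv_single,
    Ring.choose_zero_pos ℤ (by omega), show (1 : ℤ) = ((1 : ℕ) : ℤ) from rfl,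
    Ring.choose_natCast, Nat.choose_eq_zero_of_lt (by omega)]
  simp

theorem hasseDeriv_one_binomialLaurent_one :
    LaurentSeries.hasseDeriv ℂ (0 + 1) (binomialLaurent 1 0) = 1 := by
  rw [binomialLaurent_one, map_add, show (1 : LaurentSeries ℂ) = HahnSeries.single 0 1 from rfl,
    LaurentSeries.hasseDeriv_single, LaurentSeries.hasseDeriv_single]
  simp

/-- The commutator of `L(-1) + L(0)` with a residue. -/
theorem commutator_omega {n : ℤ} {a : V} (ha : a ∈ wtSpace V n) (x : M) (h : LaurentSeries ℂ) :
    Lm1 V M (resid M h a x) + L0 V M (resid M h a x) - resid M h a (Lm1 V M x + L0 V M x) =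
      resid M ((n : ℂ) • h - LaurentSeries.hasseDeriv ℂ 1 (binomialLaurent 1 0 * h)) a x := by
  obtain ⟨I, hI, h2⟩ := ((commutator_resid (VOA.omega : V) a x (binomialLaurent 1 0) h).and
    (Filter.eventually_ge_atTop 2)).exists
  obtain ⟨k, rfl⟩ := Nat.exists_eq_add_of_le' h2
  rw [resid_omega, resid_omega] at hI
  rw [hI, Finset.sum_range_succ', Finset.sum_range_succ']
  -- As 1+z is linear, only j = 0 and j = 1 contribute, with ω_(0)a = L(-1)a and ω_(1)a = na.
  rw [Finset.sum_eq_zero fun i _ => by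
    rw [show i + 1 + 1 = i + 2 from rfl, hasseDeriv_binomialLaurent_one_add_two, zero_mul, map_zero,
      LinearMap.zero_apply, LinearMap.zero_apply]]
  have h0 : (act VOA.omega ((0 : ℕ) : ℤ) a : V) = Lm1 V V a := rfl
  have h1 : (act VOA.omega ((0 + 1 : ℕ) : ℤ) a : V) = (n : ℂ) • a := mem_wtSpace.1 ha
  rw [h0, h1, hasseDeriv_one_binomialLaurent_one, LaurentSeries.hasseDeriv_zero, LinearMap.id_apply,
    resid_Lm1]
  simp only [map_sub, map_smul, LinearMap.sub_apply, LinearMap.smul_apply, zero_add]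
  rw [one_mul, sub_eq_add_neg]

theorem L0_act {n : ℤ} {a : V} (ha : a ∈ wtSpace V n) (m : ℤ) (x : M) :
    L0 V M (act a m x) = ((n : ℂ) - m - 1) • act a m x + act a m (L0 V M x) := by
  obtain ⟨I, hI, h2⟩ := ((commutator_resid (VOA.omega : V) a x (HahnSeries.single 1 1)
    (HahnSeries.single m 1)).and (Filter.eventually_ge_atTop 2)).exists
  obtain ⟨k, rfl⟩ := Nat.exists_eq_add_of_le' h2
  have h0 : (act VOA.omega ((0 : ℕ) : ℤ) a : V) = Lm1 V V a := rfl
  have h1 : (act VOA.omega ((0 + 1 : ℕ) : ℤ) a : V) = (n : ℂ) • a := mem_wtSpace.1 ha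
  rw [Finset.sum_range_succ', Finset.sum_range_succ'] at hI
  rw [Finset.sum_eq_zero fun i _ => by
    rw [LaurentSeries.hasseDeriv_single, show (1 : ℤ) = ((1 : ℕ) : ℤ) from rfl,
      Ring.choose_natCast, Nat.choose_eq_zero_of_lt (by omega), Nat.cast_zero, zero_smul,
      HahnSeries.single_eq_zero, zero_mul, map_zero,
      LinearMap.zero_apply, LinearMap.zero_apply], h0, h1, LaurentSeries.hasseDeriv_zero,
      LaurentSeries.hasseDeriv_single, LinearMap.id_apply, HahnSeries.single_mul_single] at hI
  simp only [resid_single, zero_add, Ring.choose_one_right, one_smul, mul_one, Nat.cast_one,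
    sub_self, HahnSeries.single_mul_single, act_Lm1, act_smul, LinearMap.smul_apply] at hI
  change L0 V M (act a m x) - act a m (L0 V M x) = _ at hI
  rw [show 1 + m - 1 = m by ring, ← add_smul] at hI
  rw [eq_add_of_sub_eq hI]
  congr 2
  push_cast
  ring

theorem act_mem_wtSpace {n p : ℤ} {a b : V} (ha : a ∈ wtSpace V n) (hb : b ∈ wtSpace V p) (m : ℤ) :
    (act a m b : V) ∈ wtSpace V (n + p - m - 1) := by
  rw [mem_wtSpace, L0_act ha, mem_wtSpace.1 hb, map_smul, ← add_smul]
  congr 1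
  push_cast
  ring

end Modes

/-! ### Decomposition of V under g and the weight grading. -/

section Eigen

variable {V : Type u} [AddCommGroup V] [Module ℂ V] [VOA V] (g : Aut V)

/-- The eigenvalue `exp(2πi/T)` of `g`. -/
def Aut.root : ℂ := Complex.exp (2 * Real.pi * Complex.I / g.order)

theorem Aut.mem_eig {r : ℕ} {a : V} : a ∈ g.eig r ↔ g.toEquiv a = g.root ^ r • a := by
  rw [Aut.eig, Module.End.mem_eigenspace_iff, Aut.root, ← Complex.exp_nat_mul]
  rw [show (2 * Real.pi * Complex.I * (r / g.order) : ℂ) =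
    r * (2 * Real.pi * Complex.I / g.order) by ring]
  rfl

variable {g}

theorem Aut.isPrimitiveRoot_root (hg : 0 < g.order) : IsPrimitiveRoot g.root g.order :=
  Complex.isPrimitiveRoot_exp _ hg.ne'

/-- Modes multiply V^r and V^s into V^(r+s), where r+s may reach T; this lets the label be reduced.
-/
theorem Aut.eig_congr (hg : 0 < g.order) {r s : ℕ} (h : r ≡ s [MOD g.order]) :
    g.eig r = g.eig s := by
  ext a
  rw [g.mem_eig, g.mem_eig, pow_eq_pow_mod r (Aut.isPrimitiveRoot_root hg).pow_eq_one,
    pow_eq_pow_mod s (Aut.isPrimitiveRoot_root hg).pow_eq_one, h]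

theorem Aut.act_mem_eig {r s : ℕ} {a b : V} (ha : a ∈ g.eig r) (hb : b ∈ g.eig s) (m : ℤ) :
    (act a m b : V) ∈ g.eig (r + s) := by
  rw [g.mem_eig] at *
  have h : g.toEquiv (act a m b) = act (g.toEquiv a) m (g.toEquiv b) := g.map_mode a b m
  rw [h, ha, hb, act_smul, LinearMap.smul_apply, map_smul, smul_smul, pow_add]

theorem Aut.omega_mem_eig : (VOA.omega : V) ∈ g.eig 0 := (g.mem_fixed _).2 g.map_omega

theorem Aut.vac_mem_homog : (VOA.vac : V) ∈ g.homog 0 0 :=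
  ⟨(g.mem_fixed _).2 g.map_vac, vac_mem_wtSpace⟩

theorem Aut.act_mem_homog {r s : ℕ} {n p : ℤ} {a b : V} (ha : a ∈ g.homog r n)
    (hb : b ∈ g.homog s p) (m : ℤ) : (act a m b : V) ∈ g.homog (r + s) (n + p - m - 1) :=
  ⟨Aut.act_mem_eig ha.1 hb.1 m, act_mem_wtSpace ha.2 hb.2 m⟩

theorem Aut.Lm1_mem_homog {r : ℕ} {n : ℤ} {a : V} (ha : a ∈ g.homog r n) :
    Lm1 V V a ∈ g.homog r (n + 1) := by
  refine ⟨?_, Lm1_mem_wtSpace ha.2⟩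
  have := Aut.act_mem_eig g.omega_mem_eig ha.1 0
  rwa [zero_add] at this

variable (g)

/-- The projection of `V` onto `V^r` along the other eigenspaces. -/
def Aut.proj (r : ℕ) : Module.End ℂ V :=
  (g.order : ℂ)⁻¹ • ∑ k ∈ Finset.range g.order,
    (g.root⁻¹ ^ r) ^ k • (g.toEquiv : Module.End ℂ V) ^ k

variable {g}

theorem Aut.proj_apply (r : ℕ) (a : V) : g.proj r a = (g.order : ℂ)⁻¹ •
    ∑ k ∈ Finset.range g.order, (g.root⁻¹ ^ r) ^ k • ((g.toEquiv : Module.End ℂ V) ^ k) a := by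
  simp [Aut.proj]

theorem Aut.pow_order : (g.toEquiv : Module.End ℂ V) ^ g.order = 1 := by
  have h := congrArg (fun e : V ≃ₗ[ℂ] V => (e : Module.End ℂ V)) (pow_orderOf_eq_one g.toEquiv)
  refine Eq.trans ?_ h
  exact (map_pow (LinearEquiv.automorphismGroup.toLinearMapMonoidHom (R := ℂ) (M := V))
    g.toEquiv g.order).symm

theorem Aut.root_ne_zero : g.root ≠ 0 := Complex.exp_ne_zero _

/-- Applying g shifts the summation index by one at the cost of the factor root^r, and the sum is
cyclic because the terms at k = 0 and k = T agree. -/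
theorem Aut.proj_mem_eig (hg : 0 < g.order) (r : ℕ) (a : V) : g.proj r a ∈ g.eig r := by
  rw [g.mem_eig, Aut.proj_apply, map_smul, smul_comm (g.root ^ r)]
  congr 1
  have hr : g.root ^ r * g.root⁻¹ ^ r = 1 := by
    rw [← mul_pow, mul_inv_cancel₀ Aut.root_ne_zero, one_pow]
  have hT : (g.root⁻¹ ^ r) ^ g.order = 1 := by
    rw [← pow_mul, mul_comm, pow_mul, inv_pow, (Aut.isPrimitiveRoot_root hg).pow_eq_one, inv_one,
      one_pow]
  set F : ℕ → V := fun k => (g.root⁻¹ ^ r) ^ k • ((g.toEquiv : Module.End ℂ V) ^ k) a with hF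
  have h1 : g.toEquiv (∑ k ∈ Finset.range g.order, F k) =
      g.root ^ r • ∑ k ∈ Finset.range g.order, F (k + 1) := by
    rw [map_sum, Finset.smul_sum]
    refine Finset.sum_congr rfl fun k _ => ?_
    simp only [hF, map_smul]
    rw [smul_smul, pow_succ, mul_left_comm, hr, mul_one, pow_succ']
    rfl
  have h2 : F g.order = F 0 := by
    simp only [hF, hT, Aut.pow_order, pow_zero]
  have h3 : ∑ k ∈ Finset.range g.order, F (k + 1) = ∑ k ∈ Finset.range g.order, F k := by
    have := (Finset.sum_range_succ' F g.order).symm.trans (Finset.sum_range_succ F g.order)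
    rwa [h2, add_left_inj] at this
  rw [h1, h3]

theorem Aut.pow_apply_of_mem_eig {r : ℕ} {a : V} (ha : a ∈ g.eig r) (k : ℕ) :
    ((g.toEquiv : Module.End ℂ V) ^ k) a = (g.root ^ r) ^ k • a := by
  induction k with
  | zero => simp
  | succ k ih =>
    rw [pow_succ', Module.End.mul_apply, ih, map_smul, pow_succ, mul_smul]
    congr 1
    exact g.mem_eig.1 ha

theorem geom_sum_eq_zero_of_pow_eq_one {T : ℕ} {z : ℂ} (hz : z ^ T = 1) (h1 : z ≠ 1) :
    ∑ k ∈ Finset.range T, z ^ k = 0 := by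
  have := geom_sum_mul z T
  rw [hz, sub_self] at this
  exact (mul_eq_zero.1 this).resolve_right (sub_ne_zero.2 h1)

theorem Aut.proj_of_mem (hg : 0 < g.order) {a : V} (ha : a ∈ g.eig 0) : g.proj 0 a = a := by
  rw [Aut.proj_apply]
  simp only [Aut.pow_apply_of_mem_eig ha, pow_zero, one_pow, one_smul, Finset.sum_const,
    Finset.card_range]
  rw [← Nat.cast_smul_eq_nsmul ℂ, smul_smul, inv_mul_cancel₀ (by exact_mod_cast hg.ne'), one_smul]

theorem Aut.proj_of_mem_ne (hg : 0 < g.order) {r : ℕ} (hr : r ≠ 0) (hrT : r < g.order) {a : V}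
    (ha : a ∈ g.eig r) : g.proj 0 a = 0 := by
  rw [Aut.proj_apply]
  simp only [Aut.pow_apply_of_mem_eig ha, pow_zero, one_pow, one_smul, ← Finset.sum_smul]
  rw [geom_sum_eq_zero_of_pow_eq_one _
    ((Aut.isPrimitiveRoot_root hg).pow_ne_one_of_pos_of_lt hr hrT), zero_smul, smul_zero]
  rw [← pow_mul, mul_comm, pow_mul, (Aut.isPrimitiveRoot_root hg).pow_eq_one, one_pow]

/-- Orthogonality of characters: after exchanging the sums, only the power k = 0 of g survives. -/
theorem Aut.sum_proj (hg : 0 < g.order) (a : V) : ∑ r ∈ Finset.range g.order, g.proj r a = a := by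
  simp only [Aut.proj_apply]
  rw [← Finset.smul_sum, Finset.sum_comm]
  have h : ∀ k ∈ Finset.range g.order, k ≠ 0 →
      ∑ r ∈ Finset.range g.order, (g.root⁻¹ ^ r) ^ k • ((g.toEquiv : Module.End ℂ V) ^ k) a = 0 := by
    intro k hk hk0
    rw [← Finset.sum_smul]
    simp only [← pow_mul, mul_comm _ k]
    simp only [pow_mul]
    rw [geom_sum_eq_zero_of_pow_eq_one, zero_smul]
    · rw [← pow_mul, mul_comm, pow_mul, inv_pow, (Aut.isPrimitiveRoot_root hg).pow_eq_one, inv_one,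
        one_pow]
    · exact (Aut.isPrimitiveRoot_root hg).inv.pow_ne_one_of_pos_of_lt hk0 (Finset.mem_range.1 hk)
  rw [Finset.sum_eq_single_of_mem 0 (Finset.mem_range.2 hg) h]
  simp only [pow_zero, one_smul, Finset.sum_const, Finset.card_range, Module.End.one_apply]
  rw [← Nat.cast_smul_eq_nsmul ℂ, smul_smul, inv_mul_cancel₀ (by exact_mod_cast hg.ne'), one_smul]

theorem Aut.map_mem_wtSpace {n : ℤ} {a : V} (ha : a ∈ wtSpace V n) :
    g.toEquiv a ∈ wtSpace V n := by
  rw [mem_wtSpace] at *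
  have h := g.map_mode VOA.omega a 1
  rw [g.map_omega] at h
  change g.toEquiv (L0 V V a) = L0 V V (g.toEquiv a) at h
  rw [← h, ha, map_smul]

theorem Aut.proj_mem_wtSpace (r : ℕ) {n : ℤ} {a : V} (ha : a ∈ wtSpace V n) :
    g.proj r a ∈ wtSpace V n := by
  rw [Aut.proj_apply]
  refine Submodule.smul_mem _ _ (Submodule.sum_mem _ fun k hk => Submodule.smul_mem _ _ ?_)
  clear hk
  induction k with
  | zero => exact ha
  | succ k ih =>
    rw [pow_succ']
    exact Aut.map_mem_wtSpace ih

/-- `V` is spanned by the homogeneous vectors of the eigenspaces of `g`. -/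
theorem Aut.eq_top_of_homog_le (hg : 0 < g.order) (S : Submodule ℂ V)
    (h : ∀ (r : ℕ) (n : ℤ), r < g.order → g.homog r n ≤ S) : S = ⊤ := by
  rw [eq_top_iff, ← (VOA.grading (V := V)).submodule_iSup_eq_top, iSup_le_iff]
  intro n a ha
  rw [← Aut.sum_proj hg a]
  exact Submodule.sum_mem _ fun r hr =>
    h r n (Finset.mem_range.1 hr) ⟨Aut.proj_mem_eig hg r a, Aut.proj_mem_wtSpace r ha⟩

variable (V) in
theorem bijective_coeLinearMap_wtSpace :
    Function.Bijective (DirectSum.coeLinearMap (wtSpace V)) := VOA.grading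

/-- The linear map on `V` with prescribed restrictions to the homogeneous subspaces. -/
def wtLift {N : Type*} [AddCommGroup N] [Module ℂ N] (φ : ℤ → V →ₗ[ℂ] N) : V →ₗ[ℂ] N :=
  (DirectSum.toModule ℂ ℤ N fun n => φ n ∘ₗ (wtSpace V n).subtype) ∘ₗ
    (LinearEquiv.ofBijective _ (bijective_coeLinearMap_wtSpace V)).symm.toLinearMap

theorem wtLift_of_mem {N : Type*} [AddCommGroup N] [Module ℂ N] (φ : ℤ → V →ₗ[ℂ] N) {n : ℤ} {a : V}
    (ha : a ∈ wtSpace V n) : wtLift φ a = φ n a := by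
  have h : (LinearEquiv.ofBijective _ (bijective_coeLinearMap_wtSpace V)).symm a =
      DirectSum.lof ℂ ℤ (fun n => wtSpace V n) n ⟨a, ha⟩ := by
    rw [LinearEquiv.symm_apply_eq, LinearEquiv.ofBijective_apply, DirectSum.coeLinearMap_lof]
  rw [wtLift, LinearMap.comp_apply, LinearEquiv.coe_coe, h, DirectSum.toModule_lof]
  rfl

end Eigen

/-! ### Congruences modulo the span of the a ∘_g x. -/

section Congruences

variable {V : Type u} [AddCommGroup V] [Module ℂ V] [VOA V] {g : Aut V}
variable {M : Type v} [AddCommGroup M] [Module ℂ M] [WeakModule V M]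

/-- The products are given by formulas only on homogeneous vectors of the V^r; every congruence
below is linear in each algebra element and is reduced to these by this principle. -/
theorem Aut.homog_induction (hg : 0 < g.order) {N : Type*} [AddCommGroup N] [Module ℂ N]
    (F : V →ₗ[ℂ] N) (S : Submodule ℂ N)
    (h : ∀ (r : ℕ) (n : ℤ) (a : V), r < g.order → a ∈ g.homog r n → F a ∈ S) (a : V) : F a ∈ S := by
  have := Aut.eq_top_of_homog_le hg (S.comap F) fun r n hr a ha => h r n a hr ha
  exact this.ge (Submodule.mem_top (x := a))

theorem Aut.homog_congr (hg : 0 < g.order) {r s : ℕ} (h : r ≡ s [MOD g.order]) (n : ℤ) :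
    g.homog r n = g.homog s n := by
  rw [Aut.homog, Aut.homog, Aut.eig_congr hg h]

variable (g M) in
/-- The span of the elements `a ∘_g x`. -/
def circO : Submodule ℂ M := Submodule.span ℂ (circSet g M)

theorem zhuO_eq_circO : zhuO g = circO g V := rfl

/-- Deepening the pole: apply the induction hypothesis to L(-1)a, of weight n+1, and integrate by
parts. With e the exponent and z^q the current pole, this yields (e+1)(1+z)^e z^q + q(1+z)^(e+1)
z^(q-1). Modulo the known residue at z^q only q(1+z)^e z^(q-1) remains, and q ≠ 0. -/
theorem resid_mem_circO_of_zero {r : ℕ} (hr : r < g.order) (m : ℕ) {n : ℤ} {a : V}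
    (ha : a ∈ g.homog r n) (x : M) :
    resid M (binomialLaurent ((n : ℂ) - 1 + delta r + (r : ℂ) / g.order) (-(1 + delta r) - m)) a x ∈
      circO g M := by
  induction m generalizing n a with
  | zero =>
    rw [Nat.cast_zero, sub_zero, resid_binomialLaurent]
    exact Submodule.subset_span ⟨r, n, a, x, hr, ha, rfl⟩
  | succ m ih =>
    have h0 := ih ha
    have h1 := ih (Aut.Lm1_mem_homog ha)
    rw [resid_Lm1] at h1
    set e : ℂ := (n : ℂ) - 1 + delta r + (r : ℂ) / g.order with he
    set q : ℤ := -(1 + delta r) - m with hq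
    have hq0 : (q : ℂ) ≠ 0 := by
      have : q ≠ 0 := by omega
      exact_mod_cast this
    rw [show ((n + 1 : ℤ) : ℂ) - 1 + delta r + (r : ℂ) / g.order = e + 1 by
      rw [he]; push_cast; ring] at h1
    rw [show (-(1 + delta r) - (m + 1 : ℕ) : ℤ) = q - 1 by rw [hq]; push_cast; ring]
    rw [hasseDeriv_one_binomialLaurent, add_sub_cancel_right, binomialLaurent_add_one e (q - 1),
      sub_add_cancel, Submodule.neg_mem_iff] at h1
    simp only [map_add, map_smul, LinearMap.add_apply, LinearMap.smul_apply, smul_add] at h1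
    have h2 := (Submodule.add_mem_iff_right _ (Submodule.smul_mem _ (e + 1) h0)).1 h1
    have h3 := (Submodule.add_mem_iff_left _ (Submodule.smul_mem _ (q : ℂ) h0)).1 h2
    exact (Submodule.smul_mem_iff _ hq0).1 h3

/-- Residues against `(1 + z)^(wt a - 1 + δ(r) + r/T + k) / z^(1 + δ(r) + m)` with `k ≤ m` lie in
the span of the `a ∘_g x`. -/
theorem resid_mem_circO {r : ℕ} (hr : r < g.order) {k m : ℕ} (hkm : k ≤ m) {n : ℤ} {a : V}
    (ha : a ∈ g.homog r n) (x : M) {p : ℂ} {q : ℤ}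
    (hp : p = (n : ℂ) - 1 + delta r + (r : ℂ) / g.order + k) (hq : q = -(1 + delta r) - m) :
    resid M (binomialLaurent p q) a x ∈ circO g M := by
  induction k generalizing m p q with
  | zero =>
    rw [hp, hq, Nat.cast_zero, add_zero]
    exact resid_mem_circO_of_zero hr m ha x
  | succ k ih =>
    obtain ⟨m, rfl⟩ := Nat.exists_eq_add_of_le' (show 1 ≤ m by omega)
    -- (1+z)^(p+1) z^q = (1+z)^p z^q + (1+z)^p z^(q+1): an extra factor 1+z can lower the pole by
    -- one, whence k ≤ m.
    rw [show p = (n : ℂ) - 1 + delta r + (r : ℂ) / g.order + k + 1 by rw [hp]; push_cast; ring,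
      binomialLaurent_add_one, map_add, LinearMap.add_apply, LinearMap.add_apply]
    refine Submodule.add_mem _ (ih (m := m + 1) (by omega) rfl hq) (ih (m := m) (by omega) rfl ?_)
    rw [hq]
    push_cast
    ring

/-- A commutator of residues, with suitable orders of the poles, lies in the span of the
`a ∘_g x`. -/
theorem commutator_mem_circO {s : ℕ} (hs : s < g.order) {n p : ℤ} {a b : V} (ha : a ∈ g.homog 0 n)
    (hb : b ∈ g.homog s p) (x : M) {u w : ℕ} (huw : u ≤ w) {P q : ℂ} {k : ℤ}
    (hPq : P + q = (n : ℂ) + p - 2 + delta s + (s : ℂ) / g.order + u) (hk : k = -delta s - w) :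
    resid M (binomialLaurent P (-1)) a (resid M (binomialLaurent q k) b x) -
      resid M (binomialLaurent q k) b (resid M (binomialLaurent P (-1)) a x) ∈ circO g M := by
  obtain ⟨I, hI⟩ := (commutator_resid a b x (binomialLaurent P (-1)) (binomialLaurent q k)).exists
  rw [hI]
  refine Submodule.sum_mem _ fun j _ => ?_
  rw [hasseDeriv_binomialLaurent, Finset.sum_mul, map_sum, LinearMap.sum_apply,
    LinearMap.sum_apply]
  refine Submodule.sum_mem _ fun ij hij => ?_
  rw [Finset.HasAntidiagonal.mem_antidiagonal] at hij
  rw [laurent_smul_mul, map_smul, LinearMap.smul_apply, LinearMap.smul_apply, binomialLaurent_mul]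
  have hab := Aut.act_mem_homog ha hb (j : ℤ)
  rw [zero_add] at hab
  -- The weight of a_(j)b drops with j. Derivatives falling on (1+z)^P follow this drop; the `ij.2`
  -- falling on z^(-1) leave a surplus exponent `ij.2` but deepen the pole by the same amount, so u
  -- ≤ w is enough.
  refine Submodule.smul_mem _ _ (resid_mem_circO hs (k := ij.2 + u) (m := ij.2 + w) (by omega) hab x
    ?_ ?_)
  · rw [← hij]
    push_cast
    linear_combination hPq
  · rw [hk]
    push_cast
    ring

variable (g M) in
/-- The bilinear extension of `a, x ↦ Res (1 + z)^(wt a - 1 + c) / z Y_M(a, z) x` for `a ∈ V^0`, which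
is zero for `a ∈ V^r`, `r ≠ 0`. For `c = 1` this is `a ∗_g x`, and for `c = 0` it is `x ∗_g a`. -/
def star (c : ℕ) : V →ₗ[ℂ] Module.End ℂ M :=
  (wtLift fun n => resid M (binomialLaurent ((n : ℂ) - 1 + c) (-1))) ∘ₗ g.proj 0

theorem star_of_mem (hg : 0 < g.order) (c : ℕ) {n : ℤ} {a : V} (ha : a ∈ g.homog 0 n) :
    star g M c a = resid M (binomialLaurent ((n : ℂ) - 1 + c) (-1)) a := by
  rw [star, LinearMap.comp_apply, Aut.proj_of_mem hg ha.1, wtLift_of_mem _ ha.2]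

theorem star_of_mem_ne (hg : 0 < g.order) (c : ℕ) {r : ℕ} (hr : r ≠ 0) (hrT : r < g.order) {n : ℤ}
    {a : V} (ha : a ∈ g.homog r n) : star g M c a = 0 := by
  rw [star, LinearMap.comp_apply, Aut.proj_of_mem_ne hg hr hrT ha.1, map_zero]

theorem star_one_eq_leftStar (hg : 0 < g.order) {r : ℕ} (hr : r < g.order) {n : ℤ} {a : V}
    (ha : a ∈ g.homog r n) (x : M) : star g M 1 a x = leftStar r n a x := by
  rw [leftStar]
  split_ifs with h
  · subst h
    rw [star_of_mem hg 1 ha, Nat.cast_one, sub_add_cancel, resid_binomialLaurent]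
  · rw [star_of_mem_ne hg 1 h hr ha, LinearMap.zero_apply]

theorem star_zero_eq_rightStar (hg : 0 < g.order) {r : ℕ} (hr : r < g.order) {n : ℤ} {a : V}
    (ha : a ∈ g.homog r n) (x : M) : star g M 0 a x = rightStar r n a x := by
  rw [rightStar]
  split_ifs with h
  · subst h
    rw [star_of_mem hg 0 ha, Nat.cast_zero, add_zero, resid_binomialLaurent]
  · rw [star_of_mem_ne hg 0 h hr ha, LinearMap.zero_apply]

/-- The operators `a ∗_g ·` and `· ∗_g a` preserve the span of the `a ∘_g x`. -/
theorem star_mem_circO (hg : 0 < g.order) {c : ℕ} (hc : c ≤ 1) (a : V) {y : M}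
    (hy : y ∈ circO g M) : star g M c a y ∈ circO g M := by
  refine Aut.homog_induction hg ((star g M c).flip y) _ (fun r n a hr ha => ?_) a
  rw [LinearMap.flip_apply]
  rcases Nat.eq_zero_or_pos r with rfl | h0
  · rw [star_of_mem hg c ha]
    refine (Submodule.span_le (p := (circO g M).comap
      (resid M (binomialLaurent ((n : ℂ) - 1 + c) (-1)) a))).2 ?_ hy
    rintro _ ⟨s, p, b, x, hs, hb, rfl⟩
    rw [SetLike.mem_coe, Submodule.mem_comap, Aut.circ, ← resid_binomialLaurent]
    have h1 := commutator_mem_circO hs ha hb x hc (P := (n : ℂ) - 1 + c)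
      (q := (p : ℂ) - 1 + delta s + (s : ℂ) / g.order) (k := -(1 + delta s)) (by ring)
      (by push_cast; ring)
    -- In the other term of the commutator b acts last, so that term is itself some b ∘_g y.
    refine (Submodule.sub_mem_iff_left _ ?_).1 h1
    exact resid_mem_circO (k := 0) (m := 0) hs le_rfl hb _ (by simp) (by simp)
  · rw [star_of_mem_ne hg c h0.ne' hr ha, LinearMap.zero_apply]
    exact Submodule.zero_mem _

theorem circO_le_modO (lam : ℂ) : circO g M ≤ modO g M lam :=
  Submodule.span_mono Set.subset_union_left

/-- For a ∈ V^0 of weight n and h = (1+z)^(n-1+c)/z, the integrand nh - ((1+z)h)' equals (1+z)^n/z²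
both for c = 0 and for c = 1, so the commutator is a ∘_g x. -/
theorem commutator_omega_star_mem (hg : 0 < g.order) {c : ℕ} (hc : c ≤ 1) (a : V) (x : M) :
    Lm1 V M (star g M c a x) + L0 V M (star g M c a x) -
      star g M c a (Lm1 V M x + L0 V M x) ∈ circO g M := by
  refine Aut.homog_induction hg ((Lm1 V M + L0 V M) ∘ₗ (star g M c).flip x -
    (star g M c).flip (Lm1 V M x + L0 V M x)) _ (fun r n a hr ha => ?_) a
  change Lm1 V M (star g M c a x) + L0 V M (star g M c a x) -
      star g M c a (Lm1 V M x + L0 V M x) ∈ circO g M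
  rcases Nat.eq_zero_or_pos r with rfl | h0
  · rw [star_of_mem hg c ha, commutator_omega ha.2, binomialLaurent_mul,
      hasseDeriv_one_binomialLaurent]
    have h1 : ∀ y : M, y = resid M (binomialLaurent (n : ℂ) (-2)) a x → y ∈ circO g M := by
      rintro _ rfl
      exact resid_mem_circO (k := 0) (m := 0) hr le_rfl ha _ (by simp [delta]) (by simp [delta])
    apply h1
    congr 2
    have hc' : c = 0 ∨ c = 1 := by omega
    rcases hc' with rfl | rfl
    · simp only [Nat.cast_zero, add_zero, zero_add, Int.cast_neg, Int.cast_one]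
      rw [show (1 + ((n : ℂ) - 1)) = n by ring, show (-1 - 1 : ℤ) = -2 by norm_num]
      simp only [map_sub, map_add, map_smul]
      module
    · have hb := binomialLaurent_add_one (n : ℂ) (-2)
      simp only [Nat.cast_one, zero_add, sub_add_cancel, Int.cast_neg, Int.cast_one]
      rw [show (1 + (n : ℂ) - 1) = n by ring, add_comm 1 (n : ℂ), show (-1 - 1 : ℤ) = -2 by norm_num,
        hb, show (-2 + 1 : ℤ) = -1 by norm_num]
      simp only [map_sub, map_add, map_smul]
      module
  · rw [star_of_mem_ne hg c h0.ne' hr ha]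
    simp

/-- The operators `a ∗_g ·` and `· ∗_g a` preserve `O_{g,lam}(M)`. -/
theorem star_mem_modO (hg : 0 < g.order) {c : ℕ} (hc : c ≤ 1) (a : V) {lam : ℂ} {y : M}
    (hy : y ∈ modO g M lam) : star g M c a y ∈ modO g M lam := by
  refine (Submodule.span_le (p := (modO g M lam).comap (star g M c a))).2 ?_ hy
  rintro z (hz | ⟨x, rfl⟩)
  · exact circO_le_modO _ (star_mem_circO hg hc a (Submodule.subset_span hz))
  · rw [SetLike.mem_coe, Submodule.mem_comap]
    have h1 := circO_le_modO lam (commutator_omega_star_mem hg hc a x)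
    have h2 : Lm1 V M (star g M c a x) + (L0 V M (star g M c a x) + lam • star g M c a x) ∈
        modO g M lam := Submodule.subset_span (Or.inr ⟨_, rfl⟩)
    have h3 := Submodule.sub_mem _ h2 h1
    convert h3 using 1
    simp only [map_add, map_smul]
    abel

theorem resid_eventually_eq_sum (p : ℂ) (k : ℤ) (a : V) (x : M) :
    ∀ᶠ I : ℕ in Filter.atTop, resid M (binomialLaurent p k) a x =
      ∑ j ∈ Finset.range I, Ring.choose p j • act a (k + j) x := by
  have ht : Filter.Tendsto (fun i : ℕ => (i : ℤ)) Filter.atTop Filter.atTop :=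
    tendsto_natCast_atTop_atTop
  filter_upwards [ht.eventually_ge_atTop (modeBound a x - k)] with I hI
  have := resid_binomialLaurent p (-k) a x
  rw [neg_neg] at this
  rw [this, res, finsum_eq_sum_range _ I]
  · refine Finset.sum_congr rfl fun j _ => ?_
    rw [sub_neg_eq_add, add_comm k]
  · intro j hj
    rw [act_eq_zero_of_le (by omega), smul_zero]

theorem hasseDeriv_binomialLaurent_zero (j : ℕ) (p : ℂ) :
    LaurentSeries.hasseDeriv ℂ j (binomialLaurent p 0) =
      Ring.choose p j • binomialLaurent (p - j) 0 := by
  rw [hasseDeriv_binomialLaurent, Finset.sum_eq_single_of_mem (j, 0)]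
  · simp
  · simp
  · intro ij hij hne
    rw [Finset.HasAntidiagonal.mem_antidiagonal] at hij
    have h0 : ij.2 ≠ 0 := fun h => hne (Prod.ext (by simpa [h] using hij) h)
    rw [Ring.choose_zero_pos ℤ (Nat.pos_of_ne_zero h0), Int.cast_zero, mul_zero]
    exact zero_smul ℂ (binomialLaurent _ _)

/-- Every a_(l+j)b lies in V^(r+s), whose star operators are zero. -/
theorem star_resid_eq_zero (hg : 0 < g.order) {r s : ℕ} (h : ¬ r + s ≡ 0 [MOD g.order])
    {n p : ℤ} {a b : V} (ha : a ∈ g.homog r n) (hb : b ∈ g.homog s p) (α : ℂ) (l : ℤ) (c : ℕ)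
    (x : M) : star g M c (resid V (binomialLaurent α l) a b) x = 0 := by
  obtain ⟨I, hI⟩ := (resid_eventually_eq_sum α l a b).exists
  rw [hI, map_sum, LinearMap.sum_apply]
  refine Finset.sum_eq_zero fun j _ => ?_
  have hab := Aut.act_mem_homog ha hb (l + j)
  rw [Aut.homog_congr hg (Nat.mod_modEq (r + s) g.order).symm] at hab
  rw [map_smul, star_of_mem_ne hg c (fun h0 => h h0) (Nat.mod_lt _ hg) hab, smul_zero,
    LinearMap.zero_apply]

/-- The iterate formula: the star operators of the vectors `Res (1 + z)^α z^l Y(a, z) b`. -/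
theorem star_resid_eventually_eq (hg : 0 < g.order) {r s : ℕ} (h : r + s ≡ 0 [MOD g.order])
    {n p : ℤ} {a b : V} (ha : a ∈ g.homog r n) (hb : b ∈ g.homog s p) {α β : ℂ} {l : ℤ} (c : ℕ)
    (hβ : α + β = n + p - l - 2 + c) (x : M) : ∀ᶠ I : ℕ in Filter.atTop,
      star g M c (resid V (binomialLaurent α l) a b) x =
      (∑ i ∈ Finset.range I, ((-1) ^ i * Ring.choose l i : ℤ) •
        resid M (binomialLaurent α (l - i)) a (resid M (binomialLaurent β (i - 1)) b x)) -
      ∑ i ∈ Finset.range I, ((Int.negOnePow (l + i) : ℤ) * Ring.choose l i) •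
        resid M (binomialLaurent β (l - i - 1)) b (resid M (binomialLaurent α i) a x) := by
  filter_upwards [jacobi_resid a b x l (binomialLaurent α 0) (binomialLaurent β (-1)),
    resid_eventually_eq_sum α l a b] with I hI h1
  simp only [single_mul_binomialLaurent, add_zero, ← sub_eq_add_neg] at hI
  rw [hI, h1, map_sum, LinearMap.sum_apply]
  -- Since (1+z)^α carries no power of z, its j-th divided derivative is C(α,j)(1+z)^(α-j), with the
  -- same coefficient as a_(l+j)b in the residue on V; hβ says that α-j+β is wt(a_(l+j)b)-1+c.
  refine Finset.sum_congr rfl fun j _ => ?_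
  have hab := Aut.act_mem_homog ha hb (l + j)
  rw [Aut.homog_congr hg h] at hab
  rw [map_smul, LinearMap.smul_apply, star_of_mem hg c hab, hasseDeriv_binomialLaurent_zero,
    laurent_smul_mul, map_smul, LinearMap.smul_apply, LinearMap.smul_apply, binomialLaurent_mul,
    zero_add]
  congr 5
  push_cast
  linear_combination -hβ

/-- Either r = s = 0 or r+s = T. In both cases the fractional exponents of a and b balance to an
integer. -/
theorem delta_add_div (hg : 0 < g.order) {r s : ℕ} (hr : r < g.order) (hs : s < g.order)
    (h : r + s ≡ 0 [MOD g.order]) :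
    delta r = delta s ∧ (r : ℂ) / g.order + (s : ℂ) / g.order = 1 - delta s := by
  have hd : g.order ∣ r + s := (Nat.modEq_zero_iff_dvd).1 h
  rcases Nat.eq_zero_or_pos (r + s) with h0 | h0
  · obtain ⟨rfl, rfl⟩ : r = 0 ∧ s = 0 := by omega
    simp [delta]
  · have h1 : r + s = g.order := by
      obtain ⟨k, hk⟩ := hd
      have : k = 1 := by
        rcases k with _ | _ | k
        · omega
        · rfl
        · nlinarith
      rw [hk, this, mul_one]
    have hT : (g.order : ℂ) ≠ 0 := by exact_mod_cast hg.ne'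
    have hr0 : r ≠ 0 := by omega
    have hs0 : s ≠ 0 := by omega
    simp only [delta, if_neg hr0, if_neg hs0, Nat.cast_zero, sub_zero, true_and]
    rw [← add_div, ← Nat.cast_add, h1, div_self hT]

/-- The star operators of `O_g(V)` map into the span of the `a ∘_g x`. -/
theorem star_zhuO_mem_circO (hg : 0 < g.order) {c : ℕ} (hc : c ≤ 1) {y : V} (hy : y ∈ zhuO g)
    (x : M) : star g M c y x ∈ circO g M := by
  refine (Submodule.span_le (p := (circO g M).comap ((star g M c).flip x))).2 ?_ hy
  rintro _ ⟨r, n, a, b, hr, ha, rfl⟩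
  rw [SetLike.mem_coe, Submodule.mem_comap, LinearMap.flip_apply, Aut.circ, ← resid_binomialLaurent]
  refine Aut.homog_induction hg ((star g M c).flip x ∘ₗ resid V (binomialLaurent
    ((n : ℂ) - 1 + delta r + (r : ℂ) / g.order) (-(1 + delta r))) a) _ (fun s p b hs hb => ?_) b
  rw [LinearMap.comp_apply, LinearMap.flip_apply]
  by_cases h : r + s ≡ 0 [MOD g.order]
  · obtain ⟨h1, h2⟩ := delta_add_div hg hr hs h
    obtain ⟨I, hI⟩ := (star_resid_eventually_eq hg h ha hb (M := M)
      (α := (n : ℂ) - 1 + delta r + (r : ℂ) / g.order) (l := -(1 + delta r))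
      (β := (p : ℂ) - 1 + delta s + (s : ℂ) / g.order + c) c
      (by rw [h1]; push_cast; linear_combination h2) x).exists
    rw [hI]
    refine Submodule.sub_mem _ (Submodule.sum_mem _ fun i _ => zsmul_mem ?_ _)
      (Submodule.sum_mem _ fun i _ => zsmul_mem ?_ _)
    · exact resid_mem_circO (k := 0) (m := i) hr (Nat.zero_le _) ha _ (by simp) rfl
    -- The factor z₂^(-1) adds one order to the pole, which pays for the surplus (1+z₂)^c with c ≤
    -- 1.
    · refine resid_mem_circO (k := c) (m := 1 + i) hs (by omega) hb _ rfl ?_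
      rw [h1]
      push_cast
      ring
  · rw [star_resid_eq_zero hg h ha hb]
    exact Submodule.zero_mem _

/-- The left and right star operators commute modulo the span of the `a ∘_g x`. -/
theorem star_comm_mem_circO (hg : 0 < g.order) (a b : V) (x : M) :
    star g M 1 a (star g M 0 b x) - star g M 0 b (star g M 1 a x) ∈ circO g M := by
  refine Aut.homog_induction hg ((star g M 1).flip (star g M 0 b x) -
    star g M 0 b ∘ₗ (star g M 1).flip x) _ (fun r n a hr ha => ?_) a
  change star g M 1 a (star g M 0 b x) - star g M 0 b (star g M 1 a x) ∈ circO g M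
  rcases Nat.eq_zero_or_pos r with rfl | h0
  swap
  · simp [star_of_mem_ne hg 1 h0.ne' hr ha]
  refine Aut.homog_induction hg (star g M 1 a ∘ₗ (star g M 0).flip x -
    (star g M 0).flip (star g M 1 a x)) _ (fun s p b hs hb => ?_) b
  change star g M 1 a (star g M 0 b x) - star g M 0 b (star g M 1 a x) ∈ circO g M
  rcases Nat.eq_zero_or_pos s with rfl | h0
  swap
  · simp [star_of_mem_ne hg 0 h0.ne' hs hb]
  rw [star_of_mem hg 1 ha, star_of_mem hg 0 hb]
  refine commutator_mem_circO hr ha hb x (u := 0) (w := 0) le_rfl ?_ ?_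
  · simp [delta]
    ring
  · simp [delta]

/-- Associativity of the left star operators. -/
theorem star_one_assoc_mem_circO (hg : 0 < g.order) (a b : V) (x : M) :
    star g M 1 (star g V 1 a b) x - star g M 1 a (star g M 1 b x) ∈ circO g M := by
  refine Aut.homog_induction hg ((star g M 1).flip x ∘ₗ (star g V 1).flip b -
    (star g M 1).flip (star g M 1 b x)) _ (fun r n a hr ha => ?_) a
  change star g M 1 (star g V 1 a b) x - star g M 1 a (star g M 1 b x) ∈ circO g M
  rcases Nat.eq_zero_or_pos r with rfl | h0
  swap
  · simp [star_of_mem_ne hg 1 h0.ne' hr ha]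
  refine Aut.homog_induction hg ((star g M 1).flip x ∘ₗ star g V 1 a -
    star g M 1 a ∘ₗ (star g M 1).flip x) _ (fun s p b hs hb => ?_) b
  change star g M 1 (star g V 1 a b) x - star g M 1 a (star g M 1 b x) ∈ circO g M
  rw [star_of_mem hg 1 ha, star_of_mem hg 1 ha]
  rcases Nat.eq_zero_or_pos s with rfl | h0
  swap
  · rw [star_of_mem_ne hg 1 h0.ne' hs hb, star_resid_eq_zero hg (fun h => h0.ne' ?_) ha hb]
    · simp
    · rw [zero_add] at h
      exact Nat.eq_zero_of_dvd_of_lt ((Nat.modEq_zero_iff_dvd).1 h) hs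
  rw [star_of_mem hg 1 hb]
  obtain ⟨I, hI, h1⟩ := ((star_resid_eventually_eq hg (r := 0) (s := 0) rfl ha hb (M := M)
    (α := (n : ℂ) - 1 + (1 : ℕ)) (β := (p : ℂ) - 1 + (1 : ℕ)) (l := -1) 1
    (by push_cast; ring) x).and (Filter.eventually_ge_atTop 1)).exists
  obtain ⟨k, rfl⟩ := Nat.exists_eq_add_of_le' h1
  -- The term i = 0 of the first sum is a ∗_g (b ∗_g x). In every other term of either sum the outer
  -- residue has exponent equal to the weight and a pole of order at least two.
  rw [hI, Finset.sum_range_succ']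
  simp only [Nat.cast_zero, sub_zero, zero_sub, pow_zero, Ring.choose_zero_right, mul_one, one_smul]
  rw [add_sub_right_comm, add_sub_cancel_right]
  refine Submodule.sub_mem _ (Submodule.sum_mem _ fun i _ => zsmul_mem ?_ _)
    (Submodule.sum_mem _ fun i _ => zsmul_mem ?_ _)
  · refine resid_mem_circO (k := 0) (m := i) hr (Nat.zero_le _) ha _ (by simp [delta]) ?_
    simp [delta]
    ring
  · refine resid_mem_circO (k := 0) (m := i) hr (Nat.zero_le _) hb _ (by simp [delta]) ?_
    simp [delta]
    ring

/-- Splitting (1+z)^p/z^(2+i), whose residue lies in the span, into two terms with exponent p-1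
shows that raising the pole by one only changes the sign. -/
theorem resid_add_smul_mem_circO (hg : 0 < g.order) {p : ℤ} {b : V} (hb : b ∈ g.homog 0 p)
    (y : M) (i : ℕ) :
    resid M (binomialLaurent ((p : ℂ) - 1) (-2 - i)) b y +
      (-1 : ℂ) ^ i • resid M (binomialLaurent ((p : ℂ) - 1) (-1)) b y ∈ circO g M := by
  have key : ∀ i : ℕ, resid M (binomialLaurent ((p : ℂ) - 1) (-2 - i)) b y +
      resid M (binomialLaurent ((p : ℂ) - 1) (-1 - i)) b y ∈ circO g M := by
    intro i
    have h := resid_mem_circO (k := 0) (m := i) hg (Nat.zero_le _) hb y (p := p) (q := -2 - i)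
      (by simp [delta]) (by simp [delta])
    have h2 := binomialLaurent_add_one ((p : ℂ) - 1) (-2 - i)
    rw [sub_add_cancel] at h2
    rw [h2, map_add, LinearMap.add_apply, LinearMap.add_apply] at h
    rwa [show (-2 - (i : ℤ) + 1) = -1 - i by ring] at h
  induction i with
  | zero => simpa using key 0
  | succ i ih =>
    have h := Submodule.sub_mem _ (key (i + 1)) ih
    rw [show (-1 - ((i + 1 : ℕ) : ℤ)) = -2 - i by push_cast; ring] at h
    convert h using 1
    rw [pow_succ, mul_neg_one, neg_smul]
    abel

/-- Truncated geometric series for 1/(1+z). -/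
theorem sum_binomialLaurent (p : ℂ) (I : ℕ) :
    ∑ i ∈ Finset.range I, (-1 : ℂ) ^ i • binomialLaurent p i =
      binomialLaurent (p - 1) 0 - (-1 : ℂ) ^ I • binomialLaurent (p - 1) I := by
  induction I with
  | zero => simp
  | succ I ih =>
    have h := binomialLaurent_add_one (p - 1) I
    rw [sub_add_cancel] at h
    rw [Finset.sum_range_succ, ih, h, pow_succ, Nat.cast_succ]
    module

/-- Associativity of the right star operators. -/
theorem star_zero_assoc_mem_circO (hg : 0 < g.order) (a b : V) (x : M) :
    star g M 0 (star g V 1 a b) x - star g M 0 b (star g M 0 a x) ∈ circO g M := by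
  refine Aut.homog_induction hg ((star g M 0).flip x ∘ₗ (star g V 1).flip b -
    star g M 0 b ∘ₗ (star g M 0).flip x) _ (fun r n a hr ha => ?_) a
  change star g M 0 (star g V 1 a b) x - star g M 0 b (star g M 0 a x) ∈ circO g M
  rcases Nat.eq_zero_or_pos r with rfl | h0
  swap
  · simp [star_of_mem_ne hg _ h0.ne' hr ha]
  refine Aut.homog_induction hg ((star g M 0).flip x ∘ₗ star g V 1 a -
    (star g M 0).flip (star g M 0 a x)) _ (fun s p b hs hb => ?_) b
  change star g M 0 (star g V 1 a b) x - star g M 0 b (star g M 0 a x) ∈ circO g M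
  rcases Nat.eq_zero_or_pos s with rfl | h0
  swap
  · rw [star_of_mem hg 1 ha, star_of_mem_ne hg 0 h0.ne' hs hb,
      star_resid_eq_zero hg (fun h => h0.ne' ?_) ha hb]
    · simp
    · rw [zero_add] at h
      exact Nat.eq_zero_of_dvd_of_lt ((Nat.modEq_zero_iff_dvd).1 h) hs
  have hcomm := star_comm_mem_circO hg a b x
  -- The kernels differ by ((1+z)^n - (1+z)^(n-1))/z = (1+z)^(n-1).
  have hdiff : star g M 1 a x - star g M 0 a x = resid M (binomialLaurent ((n : ℂ) - 1) 0) a x := by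
    have h := binomialLaurent_add_one ((n : ℂ) - 1) (-1)
    rw [star_of_mem hg 1 ha, star_of_mem hg 0 ha, Nat.cast_one, Nat.cast_zero, add_zero, h, map_add,
      LinearMap.add_apply, LinearMap.add_apply, add_sub_cancel_left, neg_add_cancel]
  obtain ⟨I, hI, h1, h2⟩ := ((star_resid_eventually_eq hg (r := 0) (s := 0) rfl ha hb (M := M)
    (α := (n : ℂ) - 1 + (1 : ℕ)) (β := (p : ℂ) - 1) (l := -1) 0
    (by push_cast; ring) x).and ((Filter.eventually_ge_atTop 1).and
      ((tendsto_natCast_atTop_atTop (R := ℤ)).eventually_ge_atTop (modeBound a x)))).exists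
  have hsum : resid M (binomialLaurent ((n : ℂ) - 1) 0) a x =
      ∑ i ∈ Finset.range I, (-1 : ℂ) ^ i • resid M (binomialLaurent ((n : ℂ) - 1 + (1 : ℕ)) i) a x := by
    have h := congrArg (fun f => resid M f a x) (sum_binomialLaurent (n : ℂ) I)
    simp only [map_sum, map_sub, map_smul, LinearMap.sum_apply, LinearMap.sub_apply,
      LinearMap.smul_apply] at h
    rw [resid_eq_zero (suppGE_binomialLaurent _ _) h2, smul_zero, sub_zero] at h
    rw [← h, Nat.cast_one, sub_add_cancel]
  have hcoef : ∀ i : ℕ, (Int.negOnePow (-1 + i) : ℤ) * Ring.choose (-1 : ℤ) i = -1 := by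
    intro i
    rw [Ring.choose_neg, Int.negOnePow_add, add_sub_cancel_left, Ring.choose_natCast, Nat.choose_self]
    rcases Int.units_eq_one_or (Int.negOnePow i) with h | h <;> simp [h]
  obtain ⟨k, rfl⟩ := Nat.exists_eq_add_of_le' h1
  have hB : ∀ y : M, star g M 0 b y = resid M (binomialLaurent ((p : ℂ) - 1) (-1)) b y := by
    intro y
    rw [star_of_mem hg 0 hb, Nat.cast_zero, add_zero]
  -- The first sum reduces to its leading term a ∗_g (x ∗_g b), congruent to (a ∗_g x) ∗_g b by
  -- `hcomm`.
  have hfirst : ∑ i ∈ Finset.range (k + 1), ((-1) ^ i * Ring.choose (-1) i : ℤ) •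
        resid M (binomialLaurent ((n : ℂ) - 1 + (1 : ℕ)) (-1 - i)) a
          (resid M (binomialLaurent ((p : ℂ) - 1) (i - 1)) b x) -
        star g M 1 a (star g M 0 b x) ∈ circO g M := by
    rw [Finset.sum_range_succ']
    simp only [Nat.cast_zero, sub_zero, zero_sub, pow_zero, Ring.choose_zero_right, mul_one,
      one_smul]
    rw [hB, star_of_mem hg 1 ha, add_sub_cancel_right]
    refine Submodule.sum_mem _ fun i _ => zsmul_mem ?_ _
    refine resid_mem_circO (k := 0) (m := i) hr (Nat.zero_le _) ha _ (by simp [delta]) ?_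
    simp [delta]
    ring
  -- Moving every pole of b to order one produces the signs of the geometric series for 1/(1+z₁), so
  -- the second sum becomes (a ∗_g x - x ∗_g a) ∗_g b. Subtracting it from the first leaves (x ∗_g
  -- a) ∗_g b.
  have hsecond : (∑ i ∈ Finset.range (k + 1),
        ((Int.negOnePow (-1 + i) : ℤ) * Ring.choose (-1 : ℤ) i) •
        resid M (binomialLaurent ((p : ℂ) - 1) (-1 - i - 1)) b
          (resid M (binomialLaurent ((n : ℂ) - 1 + (1 : ℕ)) i) a x)) -
        star g M 0 b (star g M 1 a x - star g M 0 a x) ∈ circO g M := by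
    rw [hdiff, hsum, map_sum, ← Finset.sum_sub_distrib]
    refine Submodule.sum_mem _ fun i _ => ?_
    have h := resid_add_smul_mem_circO hg hb
      (resid M (binomialLaurent ((n : ℂ) - 1 + (1 : ℕ)) i) a x) i
    rw [← Submodule.neg_mem_iff] at h
    convert h using 1
    rw [hcoef, hB, map_smul, show (-1 - (i : ℤ) - 1) = -2 - i by ring]
    module
  rw [star_of_mem hg 1 ha, hI]
  have h := Submodule.add_mem _ (Submodule.sub_mem _ hfirst hsecond) hcomm
  convert h using 1
  rw [map_sub]
  abel

end Congruences

/-! ### The algebra A_g(V). -/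

section Algebra

variable {V : Type u} [AddCommGroup V] [Module ℂ V] [VOA V] {g : Aut V}
variable {M : Type v} [AddCommGroup M] [Module ℂ M] [WeakModule V M]

theorem resid_vac (f : LaurentSeries ℂ) (x : M) :
    resid M f (VOA.vac : V) x = f.coeff (-1) • x := by
  rw [resid_apply, finsum_eq_single _ (-1)]
  · rw [act_vac, if_pos rfl]
  · intro n hn
    rw [act_vac, if_neg hn, smul_zero]

theorem resid_apply_vac {f : LaurentSeries ℂ} (hf : SuppGE (-1) f) (a : V) :
    resid V f a VOA.vac = f.coeff (-1) • a := by
  rw [resid_apply, finsum_eq_single _ (-1)]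
  · rw [act_neg_one_vac]
  · intro n hn
    rcases lt_or_ge n (-1) with h | h
    · rw [hf n h, zero_smul]
    · rw [act_nonneg_vac a (by omega), smul_zero]

theorem coeff_binomialLaurent_self (p : ℂ) (k : ℤ) : (binomialLaurent p k).coeff k = 1 := by
  simpa using coeff_binomialLaurent_add p k 0

theorem resid_binomialLaurent_apply_vac (p : ℂ) (a : V) :
    resid V (binomialLaurent p (-1)) a VOA.vac = a := by
  rw [resid_apply_vac (suppGE_binomialLaurent _ _), coeff_binomialLaurent_self, one_smul]

theorem star_vac (hg : 0 < g.order) (c : ℕ) (x : M) : star g M c VOA.vac x = x := by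
  rw [star_of_mem hg c Aut.vac_mem_homog, resid_vac, coeff_binomialLaurent_self, one_smul]

/-- Here δ(r) = 0, so the pole is simple and a ∘_g 𝟙 = a. -/
theorem mem_zhuO_of_ne {r : ℕ} (h0 : r ≠ 0) (hr : r < g.order) {n : ℤ} {a : V}
    (ha : a ∈ g.homog r n) : a ∈ zhuO g := by
  have h := resid_mem_circO (k := 0) (m := 0) hr le_rfl ha (VOA.vac : V)
    (p := (n : ℂ) - 1 + (r : ℂ) / g.order) (q := -1) (by simp [delta, h0]) (by simp [delta, h0])
  rwa [resid_binomialLaurent_apply_vac] at h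

theorem star_apply_vac_sub_mem (hg : 0 < g.order) (a : V) :
    star g V 1 a VOA.vac - a ∈ zhuO g := by
  refine Aut.homog_induction hg ((star g V 1).flip VOA.vac - LinearMap.id) _
    (fun r n a hr ha => ?_) a
  change star g V 1 a VOA.vac - a ∈ zhuO g
  rcases Nat.eq_zero_or_pos r with rfl | h0
  · rw [star_of_mem hg 1 ha, resid_binomialLaurent_apply_vac, sub_self]
    exact Submodule.zero_mem _
  · rw [star_of_mem_ne hg 1 h0.ne' hr ha, LinearMap.zero_apply, zero_sub, Submodule.neg_mem_iff]
    exact mem_zhuO_of_ne h0.ne' hr ha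

/-- The operators on `M / S` induced by the star operators of classes in `V / O_g(V)`, for a subspace
`S` which contains the `a ∘_g x` and is preserved by the star operators. -/
def starQ (hg : 0 < g.order) {c : ℕ} (hc : c ≤ 1) (S : Submodule ℂ M)
    (hS : ∀ (a : V), ∀ y ∈ S, star g M c a y ∈ S) (hO : circO g M ≤ S) :
    (V ⧸ zhuO g) →ₗ[ℂ] Module.End ℂ (M ⧸ S) :=
  (zhuO g).liftQ
    { toFun := fun a => S.mapQ S (star g M c a) (hS a)
      map_add' := fun a b => by
        ext x
        simp
      map_smul' := fun z a => by
        ext x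
        simp }
    (fun y hy => by
      rw [LinearMap.mem_ker]
      ext x
      simp only [LinearMap.coe_mk, AddHom.coe_mk, LinearMap.comp_apply, Submodule.mkQ_apply,
        Submodule.mapQ_apply, LinearMap.zero_apply]
      exact (Submodule.Quotient.mk_eq_zero S).2 (hO (star_zhuO_mem_circO hg hc hy x)))

theorem star_mem_zhuO (hg : 0 < g.order) {c : ℕ} (hc : c ≤ 1) (a : V) {y : V} (hy : y ∈ zhuO g) :
    star g V c a y ∈ zhuO g :=
  star_mem_circO hg hc a hy

/-- The product of `V / O_g(V)`. -/
def zhuMul (hg : 0 < g.order) : (V ⧸ zhuO g) →ₗ[ℂ] (V ⧸ zhuO g) →ₗ[ℂ] (V ⧸ zhuO g) :=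
  starQ hg le_rfl (zhuO g) (fun a _ hy => star_mem_zhuO hg le_rfl a hy) zhuO_eq_circO.ge

theorem zhuMul_mk (hg : 0 < g.order) (a b : V) :
    zhuMul hg ((zhuO g).mkQ a) ((zhuO g).mkQ b) = (zhuO g).mkQ (star g V 1 a b) := rfl

/-- The associative product of `A_g(V)`. -/
def zhuProduct (hg : 0 < g.order) : ZhuProduct g where
  mul := zhuMul hg
  mul_mk r n a b hr ha := by rw [zhuMul_mk, star_one_eq_leftStar hg hr ha]
  mul_assoc x y z := by
    obtain ⟨a, rfl⟩ := (zhuO g).mkQ_surjective x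
    obtain ⟨b, rfl⟩ := (zhuO g).mkQ_surjective y
    obtain ⟨c, rfl⟩ := (zhuO g).mkQ_surjective z
    simp only [zhuMul_mk]
    exact (Submodule.Quotient.eq _).2 (star_one_assoc_mem_circO hg a b c)
  one_mul x := by
    obtain ⟨a, rfl⟩ := (zhuO g).mkQ_surjective x
    rw [zhuMul_mk, star_vac hg]
  mul_one x := by
    obtain ⟨a, rfl⟩ := (zhuO g).mkQ_surjective x
    rw [zhuMul_mk]
    exact (Submodule.Quotient.eq _).2 (star_apply_vac_sub_mem hg a)

theorem ZhuAlgebra.of_surjective (P : ZhuProduct g) : Function.Surjective (ZhuAlgebra.of P) :=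
  (zhuO g).mkQ_surjective

theorem ZhuAlgebra.of_eq_zero (P : ZhuProduct g) {a : V} (ha : a ∈ zhuO g) :
    ZhuAlgebra.of P a = 0 :=
  (Submodule.Quotient.mk_eq_zero _).2 ha

theorem ZhuAlgebra.one_def (P : ZhuProduct g) : (1 : ZhuAlgebra P) = ZhuAlgebra.of P VOA.vac := rfl

theorem ZhuAlgebra.of_mul_of (hg : 0 < g.order) (a b : V) :
    ZhuAlgebra.of (zhuProduct hg) a * ZhuAlgebra.of (zhuProduct hg) b =
      ZhuAlgebra.of (zhuProduct hg) (star g V 1 a b) := rfl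

theorem ZhuAlgebra.of_mul_of_homog (P : ZhuProduct g) {r : ℕ} {n : ℤ} {a : V} (b : V)
    (hr : r < g.order) (ha : a ∈ g.homog r n) :
    ZhuAlgebra.of P a * ZhuAlgebra.of P b = ZhuAlgebra.of P (leftStar r n a b) :=
  P.mul_mk r n a b hr ha

end Algebra

/-! ### The epimorphism A(V^0) → A_g(V). -/

section Restriction

variable {V : Type u} [AddCommGroup V] [Module ℂ V] [VOA V] {g : Aut V}

theorem Aut.order_one : (Aut.one V).order = 1 := orderOf_one

theorem Aut.order_one_pos : 0 < (Aut.one V).order := by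
  rw [Aut.order_one]
  exact Nat.one_pos

theorem Aut.coe_res (p : ℂ) (k : ℤ) (a b : g.fixed) :
    ((res p k a b : g.fixed) : V) = res p k (a : V) (b : V) := by
  rw [res, res]
  exact (g.fixed.subtype.toAddMonoidHom).map_finsum_of_injective Subtype.val_injective _

theorem Aut.coe_mem_homog {n : ℤ} {a : g.fixed} (ha : a ∈ (Aut.one g.fixed).homog 0 n) :
    (a : V) ∈ g.homog 0 n :=
  ⟨a.2, (g.mem_eigenspace_fixed VOA.omega rfl n a).1 ha.2⟩

/-- For r = 0 the formula for ∘_g does not involve T, so it agrees with the one on V^0. -/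
theorem Aut.zhuO_one_le (hg : 0 < g.order) :
    zhuO (Aut.one g.fixed) ≤ (zhuO g).comap g.fixed.subtype := by
  refine Submodule.span_le.2 ?_
  rintro _ ⟨r, n, a, x, hr, ha, rfl⟩
  rw [Aut.order_one, Nat.lt_one_iff] at hr
  subst hr
  rw [SetLike.mem_coe, Submodule.mem_comap, Submodule.subtype_apply, Aut.circ, Aut.coe_res]
  refine Submodule.subset_span ⟨0, n, a, x, hg, Aut.coe_mem_homog ha, ?_⟩
  simp [Aut.circ]

/-- The linear map `A(V^0) → A_g(V)` induced by the inclusion. -/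
def restrictLinear (P0 : ZhuProduct (Aut.one g.fixed)) (P : ZhuProduct g) (hg : 0 < g.order) :
    ZhuAlgebra P0 →ₗ[ℂ] ZhuAlgebra P :=
  (zhuO (Aut.one g.fixed)).mapQ (zhuO g) g.fixed.subtype (Aut.zhuO_one_le hg)

theorem restrictLinear_of (P0 : ZhuProduct (Aut.one g.fixed)) (P : ZhuProduct g) (hg : 0 < g.order)
    (a : g.fixed) :
    restrictLinear P0 P hg (ZhuAlgebra.of P0 a) = ZhuAlgebra.of P (a : V) := rfl

theorem restrictLinear_mul (P0 : ZhuProduct (Aut.one g.fixed)) (P : ZhuProduct g)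
    (hg : 0 < g.order) (x y : ZhuAlgebra P0) :
    restrictLinear P0 P hg (x * y) = restrictLinear P0 P hg x * restrictLinear P0 P hg y := by
  obtain ⟨a, rfl⟩ := ZhuAlgebra.of_surjective P0 x
  obtain ⟨b, rfl⟩ := ZhuAlgebra.of_surjective P0 y
  rw [← sub_eq_zero, ← Submodule.mem_bot ℂ]
  refine Aut.homog_induction Aut.order_one_pos
    (restrictLinear P0 P hg ∘ₗ (LinearMap.mulRight ℂ (ZhuAlgebra.of P0 b)) ∘ₗ ZhuAlgebra.of P0 -
      (LinearMap.mulRight ℂ (restrictLinear P0 P hg (ZhuAlgebra.of P0 b))) ∘ₗ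
        restrictLinear P0 P hg ∘ₗ ZhuAlgebra.of P0) ⊥ (fun r n a hr ha => ?_) a
  change restrictLinear P0 P hg (ZhuAlgebra.of P0 a * ZhuAlgebra.of P0 b) -
    restrictLinear P0 P hg (ZhuAlgebra.of P0 a) * restrictLinear P0 P hg (ZhuAlgebra.of P0 b) ∈
      (⊥ : Submodule ℂ (ZhuAlgebra P))
  rw [Submodule.mem_bot, sub_eq_zero, ZhuAlgebra.of_mul_of_homog P0 b hr ha]
  rw [Aut.order_one, Nat.lt_one_iff] at hr
  subst hr
  rw [restrictLinear_of, restrictLinear_of, restrictLinear_of,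
    ZhuAlgebra.of_mul_of_homog P _ hg (Aut.coe_mem_homog ha), leftStar, leftStar, if_pos rfl,
    if_pos rfl, Aut.coe_res]

/-- The algebra homomorphism `A(V^0) → A_g(V)`. -/
def restrictHom (P0 : ZhuProduct (Aut.one g.fixed)) (P : ZhuProduct g) (hg : 0 < g.order) :
    ZhuAlgebra P0 →ₐ[ℂ] ZhuAlgebra P :=
  AlgHom.ofLinearMap (restrictLinear P0 P hg) rfl (restrictLinear_mul P0 P hg)

/-- The eigenspaces V^r with r ≠ 0 have zero image in A_g(V), so classes from V^0 exhaust it. -/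
theorem restrictHom_surjective (P0 : ZhuProduct (Aut.one g.fixed)) (P : ZhuProduct g)
    (hg : 0 < g.order) : Function.Surjective (restrictHom P0 P hg) := by
  intro y
  obtain ⟨a, rfl⟩ := ZhuAlgebra.of_surjective P y
  refine Aut.homog_induction hg (ZhuAlgebra.of P)
    (LinearMap.range (restrictHom P0 P hg).toLinearMap) (fun r n a hr ha => ?_) a
  rcases Nat.eq_zero_or_pos r with rfl | h0
  · exact ⟨ZhuAlgebra.of P0 ⟨a, ha.1⟩, rfl⟩
  · rw [ZhuAlgebra.of_eq_zero P (mem_zhuO_of_ne h0.ne' hr ha)]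
    exact Submodule.zero_mem _

end Restriction

/-! ### The bimodule B_{g,λ}(M). -/

section Bimodule

variable {V : Type u} [AddCommGroup V] [Module ℂ V] [VOA V] {g : Aut V}
variable {M : Type v} [AddCommGroup M] [Module ℂ M] [WeakModule V M]

variable (M) in
/-- The star operators on `B_{g,lam}(M)`. -/
def bimodAction (hg : 0 < g.order) {c : ℕ} (hc : c ≤ 1) (lam : ℂ) :
    ZhuAlgebra (zhuProduct hg) →ₗ[ℂ] Module.End ℂ (BQuot g M lam) :=
  starQ hg hc (modO g M lam) (fun a _ hy => star_mem_modO hg hc a hy) (circO_le_modO lam)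

theorem bimodAction_of (hg : 0 < g.order) {c : ℕ} (hc : c ≤ 1) (lam : ℂ) (a : V) (x : M) :
    bimodAction M hg hc lam (ZhuAlgebra.of _ a) (BQuot.of g lam x) =
      BQuot.of g lam (star g M c a x) := rfl

variable (M) in
/-- The left action of `A_g(V)` on `B_{g,lam}(M)`. -/
def leftAction (hg : 0 < g.order) (lam : ℂ) :
    ZhuAlgebra (zhuProduct hg) →+* Module.End ℂ (BQuot g M lam) where
  toFun := bimodAction M hg le_rfl lam
  map_one' := LinearMap.ext fun y => by
    obtain ⟨x, rfl⟩ := (modO g M lam).mkQ_surjective y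
    rw [ZhuAlgebra.one_def, bimodAction_of, star_vac hg]
    rfl
  map_mul' a b := LinearMap.ext fun y => by
    obtain ⟨a, rfl⟩ := ZhuAlgebra.of_surjective _ a
    obtain ⟨b, rfl⟩ := ZhuAlgebra.of_surjective _ b
    obtain ⟨x, rfl⟩ := (modO g M lam).mkQ_surjective y
    rw [ZhuAlgebra.of_mul_of, Module.End.mul_apply, bimodAction_of, bimodAction_of, bimodAction_of]
    exact (Submodule.Quotient.eq _).2 (circO_le_modO lam (star_one_assoc_mem_circO hg a b x))
  map_zero' := map_zero _
  map_add' := map_add _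

variable (M) in
/-- The right action of `A_g(V)` on `B_{g,lam}(M)`. -/
def rightAction (hg : 0 < g.order) (lam : ℂ) :
    (ZhuAlgebra (zhuProduct hg))ᵐᵒᵖ →+* Module.End ℂ (BQuot g M lam) where
  toFun a := bimodAction M hg zero_le_one lam a.unop
  map_one' := LinearMap.ext fun y => by
    obtain ⟨x, rfl⟩ := (modO g M lam).mkQ_surjective y
    rw [MulOpposite.unop_one, ZhuAlgebra.one_def, bimodAction_of, star_vac hg]
    rfl
  map_mul' a b := LinearMap.ext fun y => by
    obtain ⟨a, rfl⟩ := MulOpposite.op_surjective a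
    obtain ⟨b, rfl⟩ := MulOpposite.op_surjective b
    obtain ⟨a, rfl⟩ := ZhuAlgebra.of_surjective _ a
    obtain ⟨b, rfl⟩ := ZhuAlgebra.of_surjective _ b
    obtain ⟨x, rfl⟩ := (modO g M lam).mkQ_surjective y
    rw [MulOpposite.unop_mul, MulOpposite.unop_op, MulOpposite.unop_op, ZhuAlgebra.of_mul_of,
      Module.End.mul_apply, bimodAction_of, bimodAction_of, bimodAction_of]
    -- The opposite product reverses the factors: the required identity is x ∗_g (b ∗_g a) = (x ∗_g
    -- b) ∗_g a.
    exact (Submodule.Quotient.eq _).2 (circO_le_modO lam (star_zero_assoc_mem_circO hg b a x))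
  map_zero' := by rw [MulOpposite.unop_zero, map_zero]
  map_add' a b := by rw [MulOpposite.unop_add, map_add]

theorem leftAction_rightAction_comm (hg : 0 < g.order) (lam : ℂ) (a : ZhuAlgebra (zhuProduct hg))
    (b : (ZhuAlgebra (zhuProduct hg))ᵐᵒᵖ) (y : BQuot g M lam) :
    leftAction M hg lam a (rightAction M hg lam b y) =
      rightAction M hg lam b (leftAction M hg lam a y) := by
  obtain ⟨b, rfl⟩ := MulOpposite.op_surjective b
  obtain ⟨a, rfl⟩ := ZhuAlgebra.of_surjective _ a
  obtain ⟨b, rfl⟩ := ZhuAlgebra.of_surjective _ b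
  obtain ⟨x, rfl⟩ := (modO g M lam).mkQ_surjective y
  exact (Submodule.Quotient.eq _).2 (circO_le_modO lam (star_comm_mem_circO hg a b x))

end Bimodule

/-! ### Balanced tensor products under change of algebra. -/

section Restrict

/-- Every element of A is some φ(s), so the two sets of generating relations coincide. -/
theorem tensorRelVia_eq {S A : Type*} [Ring S] [Ring A] (φ : S →+* A) (hφ : Function.Surjective φ)
    (U3 B U2 : Type*) [AddCommGroup U3] [Module ℂ U3] [Module Aᵐᵒᵖ U3]
    [AddCommGroup B] [Module ℂ B] [Module A B] [Module Aᵐᵒᵖ B]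
    [AddCommGroup U2] [Module ℂ U2] [Module A U2] :
    tensorRel A U3 B U2 = tensorRelVia φ U3 B U2 := by
  apply le_antisymm
  · refine Submodule.span_le.2 ?_
    rintro _ (⟨a, u3, b, u2, rfl⟩ | ⟨a, u3, b, u2, rfl⟩)
    · obtain ⟨s, rfl⟩ := hφ a
      exact Submodule.subset_span (Or.inl ⟨s, u3, b, u2, rfl⟩)
    · obtain ⟨s, rfl⟩ := hφ a
      exact Submodule.subset_span (Or.inr ⟨s, u3, b, u2, rfl⟩)
  · refine Submodule.span_le.2 ?_
    rintro _ (⟨s, u3, b, u2, rfl⟩ | ⟨s, u3, b, u2, rfl⟩)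
    · exact Submodule.subset_span (Or.inl ⟨φ s, u3, b, u2, rfl⟩)
    · exact Submodule.subset_span (Or.inr ⟨φ s, u3, b, u2, rfl⟩)

end Restrict

section Descent

variable {A B C N : Type*} [AddCommGroup A] [Module ℂ A] [AddCommGroup B] [Module ℂ B]
  [AddCommGroup C] [Module ℂ C] [AddCommGroup N] [Module ℂ N]

/-- Descend a linear map on `A ⊗ B ⊗ C` to `A ⊗ (B / S) ⊗ C`. -/
def tripleDescend (S : Submodule ℂ B) (f : (A ⊗[ℂ] B) ⊗[ℂ] C →ₗ[ℂ] N)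
    (hf : ∀ (a : A), ∀ b ∈ S, ∀ c : C, f ((a ⊗ₜ[ℂ] b) ⊗ₜ[ℂ] c) = 0) :
    (A ⊗[ℂ] (B ⧸ S)) ⊗[ℂ] C →ₗ[ℂ] N :=
  TensorProduct.lift (TensorProduct.lift
    (LinearMap.flip (S.liftQ (LinearMap.flip (TensorProduct.curry (TensorProduct.curry f)))
      fun b hb => LinearMap.mem_ker.2 (LinearMap.ext₂ fun a c => hf a b hb c))))

end Descent

/-! ### Comparison of the coinvariants with the balanced tensor product. -/

section Coinvariants

variable {V : Type u} [AddCommGroup V] [Module ℂ V] [VOA V] {g : Aut V}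
variable {M : Type v} [AddCommGroup M] [Module ℂ M] [WeakModule V M]

/-- For `a ∈ V^0`, the element `a ∘_g x` is `(L(-1) a + L(0) a) ∗_g x`. -/
theorem resid_Lm1_add (n : ℂ) (a : V) (x : M) :
    resid M (binomialLaurent (n + 1) (-1)) (Lm1 V V a) x +
      n • resid M (binomialLaurent n (-1)) a x = resid M (binomialLaurent n (-2)) a x := by
  have hb := binomialLaurent_add_one n (-2)
  rw [resid_Lm1, hasseDeriv_one_binomialLaurent, add_sub_cancel_right,
    show (-1 - 1 : ℤ) = -2 by norm_num, hb, show (-2 + 1 : ℤ) = -1 by norm_num]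
  simp only [map_add, map_smul, LinearMap.add_apply, LinearMap.smul_apply, Int.cast_neg,
    Int.cast_one]
  module

/-- This element is a ∘_g 𝟙. -/
theorem Lm1_add_mem_zhuO (hg : 0 < g.order) {n : ℤ} {a : V} (ha : a ∈ g.homog 0 n) :
    Lm1 V V a + (n : ℂ) • a ∈ zhuO g := by
  have h := resid_mem_circO (k := 0) (m := 0) hg le_rfl ha (VOA.vac : V)
    (p := (n : ℂ)) (q := -2) (by simp [delta]) (by simp [delta])
  rwa [← resid_Lm1_add, resid_binomialLaurent_apply_vac, resid_binomialLaurent_apply_vac] at h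

variable (P : ZhuProduct g) (h1 h2 h3 : ℂ) (U3 U2 : Type*)
  [AddCommGroup U3] [Module ℂ U3] [Module (ZhuAlgebra P)ᵐᵒᵖ U3]
  [AddCommGroup U2] [Module ℂ U2] [Module (ZhuAlgebra P) U2]

theorem ZhuAlgebra.of_Lm1 (hg : 0 < g.order) {n : ℤ} {a : V} (ha : a ∈ g.homog 0 n) :
    ZhuAlgebra.of P (Lm1 V V a) = -((n : ℂ) • ZhuAlgebra.of P a) := by
  have h := ZhuAlgebra.of_eq_zero P (Lm1_add_mem_zhuO hg ha)
  rw [map_add, map_smul] at h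
  exact eq_neg_of_add_eq_zero_left h

variable {U3 U2}

/-- For r ≠ 0 this is a generator of J. For r = 0 add the left balancing relation of L(-1)a to n
times that of a: the terms acting on U³ cancel because [L(-1)a] = -n[a], and the rest is -(a ∘_g x)
in the middle factor. -/
theorem circ_mem_coinvJ [IsScalarTower ℂ (ZhuAlgebra P)ᵐᵒᵖ U3] (hg : 0 < g.order) {r : ℕ} {n : ℤ}
    {a : V} (hr : r < g.order) (ha : a ∈ g.homog r n) (u3 : U3) (x : M) (u2 : U2) :
    (u3 ⊗ₜ[ℂ] g.circ r n a x) ⊗ₜ[ℂ] u2 ∈ coinvJ P h1 h2 h3 U3 M U2 := by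
  rcases Nat.eq_zero_or_pos r with rfl | h0
  · have e1 : ((MulOpposite.op (ZhuAlgebra.of P (Lm1 V V a)) • u3) ⊗ₜ[ℂ] x) ⊗ₜ[ℂ] u2 -
        (u3 ⊗ₜ[ℂ] res ((n + 1 : ℤ) : ℂ) 1 (Lm1 V V a) x) ⊗ₜ[ℂ] u2 ∈ coinvJ P h1 h2 h3 U3 M U2 :=
      Submodule.subset_span (Or.inl (Or.inl (Or.inr
        ⟨u3, x, u2, n + 1, Lm1 V V a, Aut.Lm1_mem_homog ha, rfl⟩)))
    have e2 : ((MulOpposite.op (ZhuAlgebra.of P a) • u3) ⊗ₜ[ℂ] x) ⊗ₜ[ℂ] u2 -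
        (u3 ⊗ₜ[ℂ] res (n : ℂ) 1 a x) ⊗ₜ[ℂ] u2 ∈ coinvJ P h1 h2 h3 U3 M U2 :=
      Submodule.subset_span (Or.inl (Or.inl (Or.inr ⟨u3, x, u2, n, a, ha, rfl⟩)))
    have e3 := Submodule.neg_mem _ (Submodule.add_mem _ e1 (Submodule.smul_mem _ (n : ℂ) e2))
    convert e3 using 1
    have hc : g.circ 0 n a x = resid M (binomialLaurent (n : ℂ) (-2)) a x := by
      rw [Aut.circ, ← resid_binomialLaurent]
      simp [delta]
    rw [hc, ← resid_Lm1_add, ZhuAlgebra.of_Lm1 P hg ha, ← resid_binomialLaurent,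
      ← resid_binomialLaurent, MulOpposite.op_neg, MulOpposite.op_smul, neg_smul, smul_assoc]
    generalize MulOpposite.op (ZhuAlgebra.of P a) • u3 = u
    simp only [TensorProduct.tmul_add, TensorProduct.add_tmul, TensorProduct.neg_tmul,
      TensorProduct.tmul_smul, ← TensorProduct.smul_tmul', Int.cast_add, Int.cast_one]
    module
  · refine Submodule.subset_span (Or.inr ⟨u3, x, u2, r, n, a, h0.ne', hr, ha, ?_⟩)
    simp [Aut.circ, delta, h0.ne']

theorem mkQ_coinvJ_of_mem_modO [IsScalarTower ℂ (ZhuAlgebra P)ᵐᵒᵖ U3] (hg : 0 < g.order) {lam : ℂ}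
    (hlam : lam = h2 - h3) (u3 : U3) {y : M} (hy : y ∈ modO g M lam) (u2 : U2) :
    (coinvJ P h1 h2 h3 U3 M U2).mkQ ((u3 ⊗ₜ[ℂ] y) ⊗ₜ[ℂ] u2) = 0 := by
  refine (Submodule.Quotient.mk_eq_zero _).2 ?_
  refine (Submodule.span_le (p := (coinvJ P h1 h2 h3 U3 M U2).comap
    ((TensorProduct.mk ℂ _ U2).flip u2 ∘ₗ TensorProduct.mk ℂ U3 M u3))).2 ?_ hy
  rintro y (⟨r, n, a, x, hr, ha, rfl⟩ | ⟨x, rfl⟩)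
  · exact circ_mem_coinvJ P h1 h2 h3 hg hr ha u3 x u2
  · refine Submodule.subset_span (Or.inl (Or.inl (Or.inl ⟨u3, x, u2, ?_⟩)))
    -- The weight h₁ cancels: -h₁ + (h₁+h₂-h₃) = λ.
    exact congrArg (fun z => (u3 ⊗ₜ[ℂ] z) ⊗ₜ[ℂ] u2) (by rw [hlam]; module)

variable (U3 U2) in
/-- The linear map from `U³ ⊗ B_{g,lam}(M) ⊗ U²` onto the coinvariants. -/
def coinvLift [IsScalarTower ℂ (ZhuAlgebra P)ᵐᵒᵖ U3] (hg : 0 < g.order) {lam : ℂ}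
    (hlam : lam = h2 - h3) :
    (U3 ⊗[ℂ] BQuot g M lam) ⊗[ℂ] U2 →ₗ[ℂ] Coinvariants P h1 h2 h3 U3 M U2 :=
  tripleDescend (modO g M lam) (coinvJ P h1 h2 h3 U3 M U2).mkQ
    fun u3 _ hy u2 => mkQ_coinvJ_of_mem_modO P h1 h2 h3 hg hlam u3 hy u2

variable {lam : ℂ} [Module (ZhuAlgebra P) (BQuot g M lam)]
  [Module (ZhuAlgebra P)ᵐᵒᵖ (BQuot g M lam)]

/-- The actions on `B_{g,lam}(M)` are those induced by `a ∗_g x` and `x ∗_g a`. -/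
def IsZhuBimodule (P : ZhuProduct g) (lam : ℂ) [Module (ZhuAlgebra P) (BQuot g M lam)]
    [Module (ZhuAlgebra P)ᵐᵒᵖ (BQuot g M lam)] : Prop :=
  ∀ (a : V) (x : M),
    ZhuAlgebra.of P a • BQuot.of g lam x = BQuot.of g lam (star g M 1 a x) ∧
    MulOpposite.op (ZhuAlgebra.of P a) • BQuot.of g lam x = BQuot.of g lam (star g M 0 a x)

/-- J imposes this for homogeneous a ∈ V^0 only; both sides are linear in a and vanish on V^r for r
≠ 0. -/
theorem mkQ_leftStar_coinvJ [IsScalarTower ℂ (ZhuAlgebra P)ᵐᵒᵖ U3] (hg : 0 < g.order)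
    (a : V) (u3 : U3) (x : M) (u2 : U2) :
    (coinvJ P h1 h2 h3 U3 M U2).mkQ
      (((MulOpposite.op (ZhuAlgebra.of P a) • u3) ⊗ₜ[ℂ] x) ⊗ₜ[ℂ] u2) =
      (coinvJ P h1 h2 h3 U3 M U2).mkQ ((u3 ⊗ₜ[ℂ] star g M 1 a x) ⊗ₜ[ℂ] u2) := by
  have hlin : IsLinearMap ℂ fun a : V =>
      ((MulOpposite.op (ZhuAlgebra.of P a) • u3) ⊗ₜ[ℂ] x) ⊗ₜ[ℂ] u2 -
        (u3 ⊗ₜ[ℂ] star g M 1 a x) ⊗ₜ[ℂ] u2 :=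
    { map_add := fun a b => by
        simp only [map_add, MulOpposite.op_add, add_smul, TensorProduct.add_tmul,
          LinearMap.add_apply, TensorProduct.tmul_add]
        abel
      map_smul := fun c a => by
        simp only [map_smul, MulOpposite.op_smul, smul_assoc, ← TensorProduct.smul_tmul',
          LinearMap.smul_apply, TensorProduct.tmul_smul, smul_sub] }
  refine (Submodule.Quotient.eq _).2 (Aut.homog_induction hg hlin.mk' _ (fun r n a hr ha => ?_) a)
  rw [IsLinearMap.mk'_apply]
  rcases Nat.eq_zero_or_pos r with rfl | h0
  · refine Submodule.subset_span (Or.inl (Or.inl (Or.inr ⟨u3, x, u2, n, a, ha, ?_⟩)))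
    rw [star_one_eq_leftStar hg hr ha, leftStar, if_pos rfl]
  · rw [star_of_mem_ne hg 1 h0.ne' hr ha, ZhuAlgebra.of_eq_zero P (mem_zhuO_of_ne h0.ne' hr ha)]
    simp

theorem mkQ_rightStar_coinvJ [IsScalarTower ℂ (ZhuAlgebra P) U2] (hg : 0 < g.order)
    (a : V) (u3 : U3) (x : M) (u2 : U2) :
    (coinvJ P h1 h2 h3 U3 M U2).mkQ ((u3 ⊗ₜ[ℂ] x) ⊗ₜ[ℂ] (ZhuAlgebra.of P a • u2)) =
      (coinvJ P h1 h2 h3 U3 M U2).mkQ ((u3 ⊗ₜ[ℂ] star g M 0 a x) ⊗ₜ[ℂ] u2) := by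
  have hlin : IsLinearMap ℂ fun a : V =>
      (u3 ⊗ₜ[ℂ] x) ⊗ₜ[ℂ] (ZhuAlgebra.of P a • u2) - (u3 ⊗ₜ[ℂ] star g M 0 a x) ⊗ₜ[ℂ] u2 :=
    { map_add := fun a b => by
        simp only [map_add, add_smul, TensorProduct.add_tmul,
          LinearMap.add_apply, TensorProduct.tmul_add]
        abel
      map_smul := fun c a => by
        simp only [map_smul, smul_assoc, ← TensorProduct.smul_tmul',
          LinearMap.smul_apply, TensorProduct.tmul_smul, smul_sub] }
  refine (Submodule.Quotient.eq _).2 (Aut.homog_induction hg hlin.mk' _ (fun r n a hr ha => ?_) a)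
  rw [IsLinearMap.mk'_apply]
  rcases Nat.eq_zero_or_pos r with rfl | h0
  · refine Submodule.subset_span (Or.inl (Or.inr ⟨u3, x, u2, n, a, ha, ?_⟩))
    rw [star_zero_eq_rightStar hg hr ha, rightStar, if_pos rfl]
  · rw [star_of_mem_ne hg 0 h0.ne' hr ha, ZhuAlgebra.of_eq_zero P (mem_zhuO_of_ne h0.ne' hr ha)]
    simp

theorem tensorRel_le_ker_coinvLift [IsScalarTower ℂ (ZhuAlgebra P)ᵐᵒᵖ U3]
    [IsScalarTower ℂ (ZhuAlgebra P) U2] (hg : 0 < g.order) (hlam : lam = h2 - h3)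
    (hB : IsZhuBimodule (M := M) P lam) :
    tensorRel (ZhuAlgebra P) U3 (BQuot g M lam) U2 ≤
      LinearMap.ker (coinvLift (M := M) P h1 h2 h3 U3 U2 hg hlam) := by
  refine Submodule.span_le.2 ?_
  rintro _ (⟨a, u3, b, u2, rfl⟩ | ⟨a, u3, b, u2, rfl⟩) <;>
  obtain ⟨a, rfl⟩ := ZhuAlgebra.of_surjective P a <;>
  obtain ⟨x, rfl⟩ := (modO g M lam).mkQ_surjective b <;>
  rw [SetLike.mem_coe, LinearMap.mem_ker, map_sub, sub_eq_zero]
  · rw [(hB a x).1]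
    exact mkQ_leftStar_coinvJ P h1 h2 h3 hg a u3 x u2
  · rw [(hB a x).2]
    exact (mkQ_rightStar_coinvJ P h1 h2 h3 hg a u3 x u2).symm

theorem coinvJ_le_ker (hg : 0 < g.order) (hlam : lam = h2 - h3)
    (hB : IsZhuBimodule (M := M) P lam) :
    coinvJ P h1 h2 h3 U3 M U2 ≤ LinearMap.ker
      ((tensorRel (ZhuAlgebra P) U3 (BQuot g M lam) U2).mkQ ∘ₗ
        TensorProduct.map (TensorProduct.map LinearMap.id (modO g M lam).mkQ) LinearMap.id) := by
  refine Submodule.span_le.2 ?_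
  rintro _ (((⟨u3, x, u2, rfl⟩ | ⟨u3, x, u2, n, a, ha, rfl⟩) | ⟨u3, x, u2, n, a, ha, rfl⟩) |
    ⟨u3, x, u2, r, n, a, h0, hr, ha, rfl⟩) <;>
  rw [SetLike.mem_coe, LinearMap.mem_ker, LinearMap.comp_apply]
  · have hx : (modO g M lam).mkQ (Lm1 V M x + L0 V M x - h1 • x + (h1 + h2 - h3) • x) = 0 := by
      refine (Submodule.Quotient.mk_eq_zero _).2 (Submodule.subset_span (Or.inr ⟨x, ?_⟩))
      rw [hlam]
      module
    rw [TensorProduct.map_tmul, TensorProduct.map_tmul, hx, TensorProduct.tmul_zero,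
      TensorProduct.zero_tmul, map_zero]
  · rw [map_sub, TensorProduct.map_tmul, TensorProduct.map_tmul, TensorProduct.map_tmul,
      TensorProduct.map_tmul]
    refine (Submodule.Quotient.mk_eq_zero _).2 (Submodule.subset_span (Or.inl
      ⟨ZhuAlgebra.of P a, u3, BQuot.of g lam x, u2, ?_⟩))
    rw [(hB a x).1, star_one_eq_leftStar hg hg ha, leftStar, if_pos rfl]
    rfl
  · rw [map_sub, TensorProduct.map_tmul, TensorProduct.map_tmul, TensorProduct.map_tmul,
      TensorProduct.map_tmul]
    refine (Submodule.Quotient.mk_eq_zero _).2 ((Submodule.neg_mem_iff _).1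
      (Submodule.subset_span (Or.inr ⟨ZhuAlgebra.of P a, u3, BQuot.of g lam x, u2, ?_⟩)))
    rw [(hB a x).2, star_zero_eq_rightStar hg hg ha, rightStar, if_pos rfl, neg_sub]
    rfl
  · have hx : (modO g M lam).mkQ (res ((n : ℂ) - 1 + (r : ℂ) / g.order) 1 a x) = 0 := by
      refine (Submodule.Quotient.mk_eq_zero _).2 (Submodule.subset_span (Or.inl
        ⟨r, n, a, x, hr, ha, ?_⟩))
      simp [Aut.circ, delta, h0]
    rw [TensorProduct.map_tmul, TensorProduct.map_tmul, hx, TensorProduct.tmul_zero,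
      TensorProduct.zero_tmul, map_zero]

/-- The isomorphism of the coinvariants with `U³ ⊗_{A_g(V)} B_{g,lam}(M) ⊗_{A_g(V)} U²`. -/
def coinvEquiv [IsScalarTower ℂ (ZhuAlgebra P)ᵐᵒᵖ U3] [IsScalarTower ℂ (ZhuAlgebra P) U2]
    (hg : 0 < g.order) (hlam : lam = h2 - h3) (hB : IsZhuBimodule (M := M) P lam) :
    Coinvariants P h1 h2 h3 U3 M U2 ≃ₗ[ℂ] TripleTensor (ZhuAlgebra P) U3 (BQuot g M lam) U2 :=
  LinearEquiv.ofLinearMap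
    ((coinvJ P h1 h2 h3 U3 M U2).liftQ _ (coinvJ_le_ker P h1 h2 h3 hg hlam hB))
    ((tensorRel (ZhuAlgebra P) U3 (BQuot g M lam) U2).liftQ _
      (tensorRel_le_ker_coinvLift P h1 h2 h3 hg hlam hB))
    (Submodule.linearMap_qext _ (TensorProduct.ext_threefold fun u3 b u2 => by
      obtain ⟨x, rfl⟩ := (modO g M lam).mkQ_surjective b
      rfl))
    (Submodule.linearMap_qext _ (TensorProduct.ext_threefold fun u3 x u2 => rfl))

theorem coinvEquiv_mk [IsScalarTower ℂ (ZhuAlgebra P)ᵐᵒᵖ U3] [IsScalarTower ℂ (ZhuAlgebra P) U2]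
    (hg : 0 < g.order) (hlam : lam = h2 - h3) (hB : IsZhuBimodule (M := M) P lam)
    (u3 : U3) (x : M) (u2 : U2) :
    coinvEquiv P h1 h2 h3 hg hlam hB
      ((coinvJ P h1 h2 h3 U3 M U2).mkQ ((u3 ⊗ₜ[ℂ] x) ⊗ₜ[ℂ] u2)) =
      (tensorRel (ZhuAlgebra P) U3 (BQuot g M lam) U2).mkQ
        ((u3 ⊗ₜ[ℂ] BQuot.of g lam x) ⊗ₜ[ℂ] u2) := rfl

end Coinvariants

end TwistedZhu

end

/-! ### Assembly of the theorem. -/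

open TwistedZhu

theorem mainTheorem5
    {V : Type*} [AddCommGroup V] [Module ℂ V] [VOA V]
    (g : Aut V) (hg : 0 < g.order)
    {M : Type*} [AddCommGroup M] [Module ℂ M] [WeakModule V M]
    (G : AdmissibleGrading V M) (h1 : ℂ) (hM : G.HasConformalWeight h1) :
    ∃ (P : ZhuProduct g) (P0 : ZhuProduct (Aut.one g.fixed))
      (π : ZhuAlgebra P0 →ₐ[ℂ] ZhuAlgebra P),
      Function.Surjective π ∧
      (∀ a : g.fixed, π (ZhuAlgebra.of P0 a) = ZhuAlgebra.of P (a : V)) ∧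
      ∀ lam : ℂ,
        ∃ (_ : Module (ZhuAlgebra P) (BQuot g M lam))
          (_ : Module (ZhuAlgebra P)ᵐᵒᵖ (BQuot g M lam))
          (_ : IsScalarTower ℂ (ZhuAlgebra P) (BQuot g M lam))
          (_ : IsScalarTower ℂ (ZhuAlgebra P)ᵐᵒᵖ (BQuot g M lam))
          (_ : SMulCommClass (ZhuAlgebra P) (ZhuAlgebra P)ᵐᵒᵖ (BQuot g M lam)),
          (∀ (r : ℕ) (n : ℤ) (a : V) (x : M), r < g.order → a ∈ g.homog r n →
            ZhuAlgebra.of P a • BQuot.of g lam x = BQuot.of g lam (leftStar r n a x) ∧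
            MulOpposite.op (ZhuAlgebra.of P a) • BQuot.of g lam x =
              BQuot.of g lam (rightStar r n a x)) ∧
          ∀ (h2 h3 : ℂ), lam = h2 - h3 →
          ∀ (U2 : Type*) [AddCommGroup U2] [Module ℂ U2] [Module (ZhuAlgebra P) U2]
            [IsScalarTower ℂ (ZhuAlgebra P) U2] [IsSimpleModule (ZhuAlgebra P) U2]
            (U3 : Type*) [AddCommGroup U3] [Module ℂ U3] [Module (ZhuAlgebra P)ᵐᵒᵖ U3]
            [IsScalarTower ℂ (ZhuAlgebra P)ᵐᵒᵖ U3] [IsSimpleModule (ZhuAlgebra P)ᵐᵒᵖ U3],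
            (∀ u : U2, ZhuAlgebra.of P VOA.omega • u = h2 • u) →
            (∀ u : U3, MulOpposite.op (ZhuAlgebra.of P VOA.omega) • u = h3 • u) →
            (∃ e : Coinvariants P h1 h2 h3 U3 M U2 ≃ₗ[ℂ]
                TripleTensor (ZhuAlgebra P) U3 (BQuot g M lam) U2,
              ∀ (u3 : U3) (x : M) (u2 : U2),
                e ((coinvJ P h1 h2 h3 U3 M U2).mkQ ((u3 ⊗ₜ[ℂ] x) ⊗ₜ[ℂ] u2)) =
                  (tensorRel (ZhuAlgebra P) U3 (BQuot g M lam) U2).mkQ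
                    ((u3 ⊗ₜ[ℂ] BQuot.of g lam x) ⊗ₜ[ℂ] u2)) ∧
            (∃ e : TripleTensor (ZhuAlgebra P) U3 (BQuot g M lam) U2 ≃ₗ[ℂ]
                TripleTensorVia π.toRingHom U3 (BQuot g M lam) U2,
              ∀ (u3 : U3) (b : BQuot g M lam) (u2 : U2),
                e ((tensorRel (ZhuAlgebra P) U3 (BQuot g M lam) U2).mkQ
                    ((u3 ⊗ₜ[ℂ] b) ⊗ₜ[ℂ] u2)) =
                  (tensorRelVia π.toRingHom U3 (BQuot g M lam) U2).mkQ
                    ((u3 ⊗ₜ[ℂ] b) ⊗ₜ[ℂ] u2)) := by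
  refine ⟨zhuProduct hg, zhuProduct Aut.order_one_pos,
    restrictHom (zhuProduct Aut.order_one_pos) (zhuProduct hg) hg,
    restrictHom_surjective _ _ hg, fun a => rfl, fun lam => ?_⟩
  let mL : Module (ZhuAlgebra (zhuProduct hg)) (BQuot g M lam) :=
    Module.compHom _ (leftAction M hg lam)
  let mR : Module (ZhuAlgebra (zhuProduct hg))ᵐᵒᵖ (BQuot g M lam) :=
    Module.compHom _ (rightAction M hg lam)
  have sL : IsScalarTower ℂ (ZhuAlgebra (zhuProduct hg)) (BQuot g M lam) :=
    ⟨fun c a y => LinearMap.congr_fun (map_smul (bimodAction M hg le_rfl lam) c a) y⟩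
  have sR : IsScalarTower ℂ (ZhuAlgebra (zhuProduct hg))ᵐᵒᵖ (BQuot g M lam) :=
    ⟨fun c a y => LinearMap.congr_fun (map_smul (bimodAction M hg zero_le_one lam) c a.unop) y⟩
  have sC : SMulCommClass (ZhuAlgebra (zhuProduct hg)) (ZhuAlgebra (zhuProduct hg))ᵐᵒᵖ
      (BQuot g M lam) := ⟨fun a b y => leftAction_rightAction_comm hg lam a b y⟩
  have hB : IsZhuBimodule (M := M) (zhuProduct hg) lam := fun a x => ⟨rfl, rfl⟩
  refine ⟨mL, mR, sL, sR, sC, fun r n a x hr ha => ?_, ?_⟩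
  · rw [← star_one_eq_leftStar hg hr ha, ← star_zero_eq_rightStar hg hr ha]
    exact hB a x
  · intro h2 h3 hlam U2 _ _ _ _ _ U3 _ _ _ _ _ _ _
    refine ⟨⟨coinvEquiv (zhuProduct hg) h1 h2 h3 hg hlam hB, coinvEquiv_mk _ _ _ _ hg hlam hB⟩,
      -- The two relation subspaces are equal, so the second isomorphism is the identity on
      -- representatives.
      ⟨Submodule.quotEquivOfEq _ _ (tensorRelVia_eq _ (restrictHom_surjective _ _ hg) _ _ _),
        fun u3 b u2 => rfl⟩⟩
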